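/- **Setting.** Let $\mathcal H$ be an infinite-dimensional separable real Hilbert space. On $\mathcal H^n$ use $\langle x,y\rangle=\sum_i\langle x_i,y_i\rangle$. Write $x\otimes y=\langle x,\cdot\rangle y$; $\|\cdot\|_{\mathcal L}$ for the operator norm; $\|\cdot\|_{\mathcal S}$, $\langle\cdot,\cdot\rangle_{\mathcal S}$ for the Hilbert–Schmidt (H-S) norm and inner product; $\mathscr C_{X,Y}=\mathbb E[(X-\mathbb EX)\otimes(Y-\mathbb EY)]$ and $\mathscr C_X=\mathscr C_{X,X}$. "Eigenpairs" of a compact positive semi-definite operator are listed with decreasing eigenvalues and orthonormal eigenvectors. All limits are for $N\to\infty$. **Process.** Let $p,q\ge 1$ and let $(X_k)_{k\in\mathbb Z}\subset L^2_{\mathcal H}$ be a centered, strictly stationary fARMA$(p,q)$ process, $$X_k=\varepsilon_k+\sum_{i=1}^p\alpha_i(X_{k-i})+\sum_{j=1}^q\beta_j(\varepsilon_{k-j})\quad\text{a.s.},\ k\in\mathbb Z,$$ with bounded operators $\alpha_i,\beta_j$, $\alpha_p\neq0$, $\beta_q\ne0$, and a strictly stationary, ergodic white noise $(\varepsilon_k)\subset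 L^4_{\mathcal H}$ with injective $\mathscr C_{\varepsilon_0}$. Suppose it is causal and invertible: there are bounded operators $\phi_j,\psi_j$ with $\sum_j\|\phi_j\|_{\mathcal L}<\infty$ and $X_k=\varepsilon_k+\sum_{j\ge1}\phi_j(\varepsilon_{k-j})$, $X_k=\sum_{j\ge1}\psi_j(X_{k-j})+\varepsilon_k$ a.s. Let $X_k^{[L]}=(X_k,\dots,X_{k-L+1})^\top$, $\Psi_L=(\psi_1\cdots\psi_L)$, $B_q=(\beta_1\cdots\beta_q)$, $\Psi'_{[i]}=(\psi_{p+q+i-1}\cdots\psi_{p+i}):\mathcal H^q\to\mathcal H$, and let $\Pi:\mathcal H^q\to\mathcal H^q$ be the operator with rows $\Psi'_{[q-1]},\dots,\Psi'_{[0]}$. **Estimators.** Let $L=L_N$, $K=K_N$, $M=M_N$ be sequences of positive integers tending to infinity and $\theta_N,\gamma_N>0$ sequences tending to $0$. From $X_1,\dots,X_N$ put $$\hat{\mathscr C}=\tfrac1{N-L+1}\sum_{k=L}^N X^{[L]}_k\otimes X^{[L]}_k,\qquad \hat{\mathscr D}=\tfrac1{N-L}\sum_{k=L}^{N-1}X^{[L]}_k\otimes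 X_{k+1},\qquad \hat\Psi_L=\hat{\mathscr D}(\hat{\mathscr C}+\theta_N\mathbb I)^{-1}\hat P_K,$$ where $\hat P_K$ is the orthogonal projection onto the span of the first $K$ eigenvectors of $\hat{\mathscr C}$. Let $\hat\psi_i$ be the $i$-th component of $\hat\Psi_L$ ($0$ for $i>L$), let $\hat\Psi'_{[i]},\hat\Pi$ be $\Psi'_{[i]},\Pi$ with $\hat\psi$ in place of $\psi$, and let $$\hat B_q=-\hat\Psi'_{[q]}\hat\Pi^*(\hat\Pi\hat\Pi^*+\gamma_N\mathbb I)^{-1}\hat Q_M,$$ where $\hat Q_M$ is the orthogonal projection onto the span of the first $M$ eigenvectors of $\hat\Pi\hat\Pi^*$ (any choice of eigenvectors is allowed in both projections). Let $\hat\beta_j$ be the $j$-th component of $\hat B_q$ for $1\le j\le q$, $\hat\beta_j=0$ for $j>q$, and $$\hat\alpha_i=\hat\psi_i-\hat\beta_i+\sum_{j=1}^{i-1}\hat\beta_j\hat\psi_{i-j},\qquad 1\le i\le p.$$ **First-stage assumptions.** Let $(\lambda_j,c_j)=(\lambda_j(L),c_j(L))$ and $(\mu_j,d_j)$ be the eigenpairs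 of $\mathscr C_{X_0^{[L]}}$ and $\mathscr C_{X_0}$, and $\Lambda_K=\sup_{1\le j\le K}(\lambda_j-\lambda_{j+1})^{-1}$. Assume: 1. $L=\mathrm o(N^{1/3})$, $\|\hat{\mathscr C}-\mathscr C_{X^{[L]}_0}\|_{\mathcal S}=\mathrm O_{\mathbb P}(L^{3/2}N^{-1/2})$, $\|\hat{\mathscr D}-\mathscr C_{X^{[L]}_0,X_1}\|_{\mathcal S}=\mathrm O_{\mathbb P}(LN^{-1/2})$; 2. $\lambda_j(L_N)\ne\lambda_{j+1}(L_N)$ for all $j$ and $N$; 3. all $\psi_i$ are H-S, $\sum_i\|\psi_i\|_{\mathcal S}^2<\infty$ and $\sum_i\|\psi_i\|_{\mathcal L}<\infty$; 4. for some $\beta>0$, with $s_{ij}=\langle\Psi_{L},c_i\otimes d_j\rangle_{\mathcal S}^2(1+i^{2\beta}+j^{2\beta})$, one has $\sum_{i\ge1}\sum_{j\ge1}s_{ij}<\infty$ for every $N$, and $\limsup_{N}\sum_{i>K}\sum_{j\ge1}s_{ij}<\infty$ (the latter holds in particular if the whole sums converge to a finite limit as $N\to\infty$); 5. $\theta_N=\mathrm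 o(\lambda_K)$, $K^{1+\beta}\lambda_K^{-1}\Lambda_KL^2=\mathrm O(N^{1/2})$, $\sum_{\ell>L}\|\psi_\ell\|_{\mathcal L}=\mathrm o(K\Lambda_KL^{3/2}N^{-1/2})$, $\theta_N=\mathrm o(K\Lambda_KL^2N^{-1/2})$. **Second-stage assumptions.** Let $(\zeta_j,h_j)$ be the eigenpairs of $\Pi\Pi^*$ and $Z_M=\sup_{1\le j\le M}(\zeta_j-\zeta_{j+1})^{-1}$. Assume: 6. $\alpha_1,\dots,\alpha_p,\beta_1,\dots,\beta_q$ are H-S; the image of $\Pi$ is dense in $\mathcal H^q$; $\zeta_j\ne\zeta_{j+1}$ for all $j$; 7. for some $\gamma>0$, $\sum_{i,j\ge1}\langle B_q,h_i\otimes d_j\rangle_{\mathcal S}^2(1+i^{2\gamma}+j^{2\gamma})<\infty$; 8. $M^{1+\gamma}\zeta_M^{-1}Z_M=\mathrm O(K^\beta)$ and $\gamma_N=\mathrm o(\zeta_MM^{-\gamma})$. **Conclusion.** $$\max_{1\le i\le p,\,1\le j\le q}\big\{\|\hat\alpha_i-\alpha_i\|_{\mathcal S},\ \|\hat\beta_j-\beta_j\|_{\mathcal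 S}\big\}=\mathrm O_{\mathbb P}(M^{-\gamma}).$$ -/

import Mathlib

open MeasureTheory Filter Topology Asymptotics
open scoped ENNReal

namespace FARMA

noncomputable section

section Operators

variable {E F : Type*}
  [NormedAddCommGroup E] [InnerProductSpace ℝ E]
  [NormedAddCommGroup F] [InnerProductSpace ℝ F]

/-- The tensorial product `x ⊗ y = ⟨x, ·⟩ y`. -/
def tensor (x : E) (y : F) : E →L[ℝ] F := InnerProductSpace.rankOne ℝ y x

theorem tensor_apply (x : E) (y : F) (z : E) : tensor x y z = inner ℝ x z • y := by
  simp [tensor]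

/-- The index set of a fixed complete orthonormal system of `E`. -/
def basisIndex (E : Type*) [NormedAddCommGroup E] [InnerProductSpace ℝ E] [CompleteSpace E] :
    Set E := (exists_hilbertBasis ℝ E).choose

/-- A fixed complete orthonormal system of `E`; the Hilbert-Schmidt norm does not depend on it,
see `hsENorm_eq`. -/
def basis (E : Type*) [NormedAddCommGroup E] [InnerProductSpace ℝ E] [CompleteSpace E] :
    HilbertBasis (basisIndex E) ℝ E := (exists_hilbertBasis ℝ E).choose_spec.choose

/-- The Hilbert-Schmidt norm `(∑ᵢ ‖T bᵢ‖²)^{1/2}`, with value `∞` when `T` is not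
Hilbert-Schmidt. -/
def hsENorm [CompleteSpace E] (T : E →L[ℝ] F) : ℝ≥0∞ :=
  (∑' i, ‖T (basis E i)‖ₑ ^ 2) ^ (1 / 2 : ℝ)

/-- `T` is a Hilbert-Schmidt operator. -/
def IsHS [CompleteSpace E] (T : E →L[ℝ] F) : Prop := hsENorm T ≠ ⊤

/-- The Hilbert-Schmidt inner product `⟨A, B⟩_S = ∑ᵢ ⟨A bᵢ, B bᵢ⟩`. -/
def hsInner [CompleteSpace E] (A B : E →L[ℝ] F) : ℝ :=
  ∑' i, inner ℝ (A (basis E i)) (B (basis E i))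

theorem tsum_inner_sq {ι : Type*} (b : HilbertBasis ι ℝ F) (y : F) :
    ∑' i, ‖(inner ℝ (b i) y : ℝ)‖ₑ ^ 2 = ‖y‖ₑ ^ 2 := by
  have h := b.hasSum_inner_mul_inner y y
  have h2 : HasSum (fun i => ‖(inner ℝ (b i) y : ℝ)‖ ^ 2) (‖y‖ ^ 2) := by
    rw [← real_inner_self_eq_norm_sq]
    refine h.congr_fun fun i => ?_
    rw [Real.norm_eq_abs, sq_abs, real_inner_comm y (b i), sq]
  have h3 : ∀ x : ℝ, ‖x‖ₑ ^ 2 = ENNReal.ofReal (‖x‖ ^ 2) := fun x => by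
    rw [← ofReal_norm, ENNReal.ofReal_pow (norm_nonneg _)]
  rw [← ofReal_norm y, ← ENNReal.ofReal_pow (norm_nonneg _), ← h2.tsum_eq,
    ENNReal.ofReal_tsum_of_nonneg (fun i => by positivity) h2.summable]
  exact tsum_congr fun i => h3 _

theorem tsum_sq_eq_adjoint [CompleteSpace E] [CompleteSpace F] {ι κ : Type*}
    (b : HilbertBasis ι ℝ E) (c : HilbertBasis κ ℝ F) (T : E →L[ℝ] F) :
    ∑' i, ‖T (b i)‖ₑ ^ 2 = ∑' j, ‖ContinuousLinearMap.adjoint T (c j)‖ₑ ^ 2 := by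
  simp_rw [← tsum_inner_sq c, ← tsum_inner_sq b]
  rw [ENNReal.tsum_comm]
  refine tsum_congr fun j => tsum_congr fun i => ?_
  rw [ContinuousLinearMap.adjoint_inner_right, real_inner_comm]

/-- The Hilbert-Schmidt norm can be computed in any complete orthonormal system. -/
theorem hsENorm_eq [CompleteSpace E] [CompleteSpace F] {ι : Type*}
    (b : HilbertBasis ι ℝ E) (T : E →L[ℝ] F) :
    hsENorm T = (∑' i, ‖T (b i)‖ₑ ^ 2) ^ (1 / 2 : ℝ) := by
  rw [hsENorm, tsum_sq_eq_adjoint (basis E) (basis F), tsum_sq_eq_adjoint b (basis F)]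

theorem hsInner_tensor [CompleteSpace E] [CompleteSpace F] (A : E →L[ℝ] F) (x : E) (y : F) :
    hsInner A (tensor x y) = inner ℝ (A x) y := by
  have h := (basis E).hasSum_inner_mul_inner x (ContinuousLinearMap.adjoint A y)
  rw [ContinuousLinearMap.adjoint_inner_right] at h
  rw [hsInner, ← h.tsum_eq]
  refine tsum_congr fun i => ?_
  rw [tensor_apply, inner_smul_right, ContinuousLinearMap.adjoint_inner_right]

/-- `(v j, e j)` is the sequence of eigenvalue/eigenfunction pairs of the positive semi-definite
operator `T`, in decreasing order: `e` is orthonormal and `T = ∑ⱼ v j (e j ⊗ e j)`. Index `j`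
stands for the `(j+1)`-th pair. -/
structure IsEigenSystem (T : E →L[ℝ] E) (v : ℕ → ℝ) (e : ℕ → E) : Prop where
  orthonormal : Orthonormal ℝ e
  antitone : Antitone v
  nonneg : ∀ j, 0 ≤ v j
  hasSum : ∀ x, HasSum (fun j => v j • tensor (e j) (e j) x) (T x)

/-- The orthogonal projection onto the span of the first `K` members of the orthonormal
sequence `e`. -/
def projFirst (e : ℕ → E) (K : ℕ) : E →L[ℝ] E := ∑ j ∈ Finset.range K, tensor (e j) (e j)

/-- `sup_{1 ≤ j ≤ K} (v_j - v_{j+1})⁻¹` (with `v j` standing for `v_{j+1}`). -/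
def gapSup (v : ℕ → ℝ) (K : ℕ) : ℝ := ⨆ j : Fin K, (v j - v (j + 1))⁻¹

/-- The regularized operator `D (C + θ I)⁻¹ P`, where `P` is the projection onto the span of
the first `K` members of `e`. -/
def tychonoff (D : E →L[ℝ] F) (C : E →L[ℝ] E) (θ : ℝ) (e : ℕ → E) (K : ℕ) : E →L[ℝ] F :=
  D ∘L Ring.inverse (C + θ • ContinuousLinearMap.id ℝ E) ∘L projFirst e K

/-- The part `i > m` of the Sobolev sum
`∑_{i ≥ 1} ∑_{j ≥ 1} ⟨A, e_i ⊗ d_j⟩_S² (1 + i^{2s} + j^{2s})`; the whole sum for `m = 0`.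
The sequences are indexed from `0`, so `e (m + i)` is `e_{m + i + 1}` and `d j` is `d_{j + 1}`. -/
def sobolevSum [CompleteSpace E] (A : E →L[ℝ] F) (e : ℕ → E) (d : ℕ → F) (s : ℝ) (m : ℕ) :
    ℝ≥0∞ :=
  ∑' i : ℕ, ∑' j : ℕ, ENNReal.ofReal (hsInner A (tensor (e (m + i)) (d j)) ^ 2 *
    (1 + ((m + i + 1 : ℕ) : ℝ) ^ (2 * s) + ((j + 1 : ℕ) : ℝ) ^ (2 * s)))

end Operators

section Blocks

variable {H : Type*} [NormedAddCommGroup H] [InnerProductSpace ℝ H]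

/-- The Cartesian power `H^n` as a Hilbert space. -/
abbrev HPow (H : Type*) (n : ℕ) : Type _ := PiLp 2 (fun _ : Fin n => H)

/-- The `i`-th coordinate embedding `H → H^n`. -/
def embed {n : ℕ} (i : Fin n) : H →L[ℝ] HPow H n :=
  ((PiLp.continuousLinearEquiv 2 ℝ (fun _ : Fin n => H)).symm :
    (Fin n → H) →L[ℝ] HPow H n) ∘L ContinuousLinearMap.single ℝ (fun _ : Fin n => H) i

/-- The row `(A 0 ⋯ A (n-1)) : H^n → H`. -/
def rowOp {n : ℕ} (A : Fin n → H →L[ℝ] H) : HPow H n →L[ℝ] H :=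
  ∑ i, A i ∘L PiLp.proj 2 (fun _ : Fin n => H) i

/-- The operator `H^n → H^m` with rows `R 0, …, R (m-1)`. -/
def ofRows {m n : ℕ} (R : Fin m → HPow H n →L[ℝ] H) : HPow H n →L[ℝ] HPow H m :=
  ∑ i, embed i ∘L R i

/-- The `j`-th component, `1 ≤ j ≤ n`, of an operator `H^n → H`; zero for other `j`. -/
def component {n : ℕ} (A : HPow H n →L[ℝ] H) (j : ℕ) : H →L[ℝ] H :=
  if h : 1 ≤ j ∧ j ≤ n then A ∘L embed ⟨j - 1, by omega⟩ else 0

theorem rowOp_apply {n : ℕ} (A : Fin n → H →L[ℝ] H) (x : HPow H n) :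
    rowOp A x = ∑ i, A i (x i) := by
  simp [rowOp]

theorem ofRows_apply {m n : ℕ} (R : Fin m → HPow H n →L[ℝ] H) (x : HPow H n) (i : Fin m) :
    ofRows R x i = R i x := by
  simp [ofRows, embed, Pi.single_apply]

theorem component_rowOp {n : ℕ} (A : ℕ → H →L[ℝ] H) {j : ℕ} (h1 : 1 ≤ j) (h2 : j ≤ n) :
    component (rowOp fun i : Fin n => A (i + 1)) j = A j := by
  ext x
  rw [component, dif_pos ⟨h1, h2⟩, ContinuousLinearMap.comp_apply, rowOp_apply,
    Finset.sum_eq_single ⟨j - 1, by omega⟩]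
  · simp [embed, Nat.sub_add_cancel h1]
  · intro b _ hb
    simp [embed, hb]
  · simp

/-- `Ψ'_[i] = (ψ_{p+q+i-1} ⋯ ψ_{p+i}) : H^q → H`, for a sequence `ψ` indexed from `1`. -/
def psiRow (ψ : ℕ → H →L[ℝ] H) (p q i : ℕ) : HPow H q →L[ℝ] H :=
  rowOp fun b : Fin q => ψ (p + q + i - 1 - b)

/-- The operator `∏ : H^q → H^q` with rows `Ψ'_[q-1], …, Ψ'_[0]`. -/
def blockOp (ψ : ℕ → H →L[ℝ] H) (p q : ℕ) : HPow H q →L[ℝ] HPow H q :=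
  ofRows fun a : Fin q => psiRow ψ p q (q - 1 - a)

/-- The operator `∏ ∏*`. -/
def blockGram [CompleteSpace H] (ψ : ℕ → H →L[ℝ] H) (p q : ℕ) : HPow H q →L[ℝ] HPow H q :=
  blockOp ψ p q ∘L ContinuousLinearMap.adjoint (blockOp ψ p q)

end Blocks

section Processes

variable {Ω : Type*} [MeasurableSpace Ω]
  {E F : Type*}
  [NormedAddCommGroup E] [InnerProductSpace ℝ E]
  [NormedAddCommGroup F] [InnerProductSpace ℝ F]

/-- The cross-covariance operator `E[(X - E X) ⊗ (Y - E Y)]` (a Bochner integral). -/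
def crossCov (μ : Measure Ω) (X : Ω → E) (Y : Ω → F) : E →L[ℝ] F :=
  ∫ ω, tensor (X ω - ∫ ω', X ω' ∂μ) (Y ω - ∫ ω', Y ω' ∂μ) ∂μ

/-- The covariance operator. -/
def covOp (μ : Measure Ω) (X : Ω → E) : E →L[ℝ] E := crossCov μ X X

/-- All `X k` are integrable with mean zero. -/
def IsCentered (μ : Measure Ω) (X : ℤ → Ω → E) : Prop :=
  ∀ k, Integrable (X k) μ ∧ ∫ ω, X k ω ∂μ = 0

/-- Strict stationarity. -/
def IsStationary [MeasurableSpace E] (μ : Measure Ω) (X : ℤ → Ω → E) : Prop :=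
  (∀ k, AEMeasurable (X k) μ) ∧ ∀ (n : ℕ) (t : Fin n → ℤ) (h : ℤ),
    μ.map (fun ω i => X (t i) ω) = μ.map (fun ω i => X (t i + h) ω)

/-- Stationarity and ergodicity: the law of the path is invariant and ergodic under the shift. -/
def IsStationaryErgodic [MeasurableSpace E] (μ : Measure Ω) (X : ℤ → Ω → E) : Prop :=
  IsStationary μ X ∧
    Ergodic (fun (x : ℤ → E) (k : ℤ) => x (k + 1)) (μ.map fun ω k => X k ω)

/-- Weak stationarity. -/
structure IsWeaklyStationary (μ : Measure Ω) (X : ℤ → Ω → E) : Prop where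
  memLp : ∀ k, MemLp (X k) 2 μ
  mean : ∃ m : E, ∀ k, ∫ ω, X k ω ∂μ = m
  cov : ∀ h k l : ℤ, crossCov μ (X k) (X l) = crossCov μ (X (k + h)) (X (l + h))

/-- White noise. -/
structure IsWhiteNoise (μ : Measure Ω) (ε : ℤ → Ω → E) : Prop where
  centered : IsCentered μ ε
  weaklyStationary : IsWeaklyStationary μ ε
  pos : ∀ k, 0 < ∫ ω, ‖ε k ω‖ ^ 2 ∂μ
  uncorrelated : ∀ k l, k ≠ l → crossCov μ (ε k) (ε l) = 0

/-- `X_k = ε_k + ∑_{i=1}^p α_i X_{k-i} + ∑_{j=1}^q β_j ε_{k-j}` a.s., with a white noise `ε`,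
a centered `X`, `α_p ≠ 0` and `β_q ≠ 0`. -/
structure IsFARMA (μ : Measure Ω) (X ε : ℤ → Ω → E) (p q : ℕ) (α β : ℕ → E →L[ℝ] E) :
    Prop where
  centered : IsCentered μ X
  whiteNoise : IsWhiteNoise μ ε
  left_ne_zero : α p ≠ 0
  right_ne_zero : β q ≠ 0
  eqn : ∀ k : ℤ, ∀ᵐ ω ∂μ, X k ω = ε k ω + ∑ i ∈ Finset.Icc 1 p, α i (X (k - i) ω) +
    ∑ j ∈ Finset.Icc 1 q, β j (ε (k - j) ω)

/-- `X` is stationary, centered, and `X_k = ∑_{j ≥ 1} ψ_j X_{k-j} + ε_k` a.s. -/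
structure IsInvertible [MeasurableSpace E] (μ : Measure Ω) (X ε : ℤ → Ω → E)
    (ψ : ℕ → E →L[ℝ] E) : Prop where
  centered : IsCentered μ X
  stationary : IsStationary μ X
  eqn : ∀ k : ℤ, ∀ᵐ ω ∂μ,
    HasSum (fun j : ℕ => ψ (j + 1) (X (k - (j + 1 : ℕ)) ω)) (X k ω - ε k ω)

/-- `X_k = ε_k + ∑_{j ≥ 1} φ_j ε_{k-j}` a.s., with `∑_j ‖φ_j‖ < ∞`. -/
structure IsCausalLinear (μ : Measure Ω) (X ε : ℤ → Ω → E) (φ : ℕ → E →L[ℝ] E) : Prop where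
  summable : Summable fun j : ℕ => ‖φ (j + 1)‖
  eqn : ∀ k : ℤ, ∀ᵐ ω ∂μ,
    HasSum (fun j : ℕ => φ (j + 1) (ε (k - (j + 1 : ℕ)) ω)) (X k ω - ε k ω)

/-- `Y_N = O_P(r_N)` as `N → ∞`, i.e. `Y_N / r_N` is stochastically bounded. -/
def IsBigOP (μ : Measure Ω) (Y : ℕ → Ω → ℝ≥0∞) (r : ℕ → ℝ) : Prop :=
  ∀ δ : ℝ, 0 < δ → ∃ C : ℝ, ∀ᶠ N in atTop,
    μ {ω | ENNReal.ofReal (C * r N) < Y N ω} ≤ ENNReal.ofReal δ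

end Processes

section Estimators

variable {Ω : Type*} {H : Type*} [NormedAddCommGroup H] [InnerProductSpace ℝ H]

/-- `X_k^{[L]} = (X_k, X_{k-1}, …, X_{k-L+1})`. -/
def lagVec (X : ℤ → Ω → H) (L : ℕ) (k : ℤ) (ω : Ω) : HPow H L :=
  WithLp.toLp 2 fun i : Fin L => X (k - (i : ℕ)) ω

/-- The empirical covariance operator of `X^{[L]}` from `X_1, …, X_N`. -/
def empCov (X : ℤ → Ω → H) (L N : ℕ) (ω : Ω) : HPow H L →L[ℝ] HPow H L :=
  ((N : ℝ) - L + 1)⁻¹ • ∑ k ∈ Finset.Icc L N, tensor (lagVec X L k ω) (lagVec X L k ω)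

/-- The empirical lag-1 cross-covariance operator of `X^{[L]}` and `X` from `X_1, …, X_N`. -/
def empCross (X : ℤ → Ω → H) (L N : ℕ) (ω : Ω) : HPow H L →L[ℝ] H :=
  ((N : ℝ) - L)⁻¹ • ∑ k ∈ Finset.Ico L N, tensor (lagVec X L k ω) (X (k + 1) ω)

/-- The estimators `ψ̂_j`, `j ≥ 1`: the components of the first-stage estimator `Ψ̂_L`
(zero for `j > L`). Here `e` are the eigenfunctions of `empCov X L N ω`. -/
def psiHat (X : ℤ → Ω → H) (L K N : ℕ) (θ : ℝ) (ω : Ω) (e : ℕ → HPow H L) (j : ℕ) :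
    H →L[ℝ] H :=
  component (tychonoff (empCross X L N ω) (empCov X L N ω) θ e K) j

/-- The estimator `B̂_q = - Ψ̂'_[q] ∏̂* (∏̂ ∏̂* + γ I)⁻¹ P`, from the estimates `ψ` of the `ψ_j`,
with `P` the projection onto the first `M` eigenfunctions `e` of `∏̂ ∏̂*`. -/
def bHat [CompleteSpace H] (ψ : ℕ → H →L[ℝ] H) (p q M : ℕ) (γ : ℝ) (e : ℕ → HPow H q) :
    HPow H q →L[ℝ] H :=
  -tychonoff (psiRow ψ p q q ∘L ContinuousLinearMap.adjoint (blockOp ψ p q))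
    (blockGram ψ p q) γ e M

/-- `ψ_i - β_i + ∑_{j=1}^{i-1} β_j ψ_{i-j}`, where `β_j` is the `j`-th component of `B`
(zero for `j > q`). -/
def alphaHat {q : ℕ} (ψ : ℕ → H →L[ℝ] H) (B : HPow H q →L[ℝ] H) (i : ℕ) : H →L[ℝ] H :=
  ψ i - component B i + ∑ j ∈ Finset.Icc 1 (i - 1), component B j ∘L ψ (i - j)

end Estimators

end

end FARMA

open FARMA

set_option linter.unusedSectionVars false

namespace FARMA

noncomputable section

/-! Both stages are Tychonoff-regularised solutions of an operator equation `D ≈ A C` with `C`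
positive and injective, and one deterministic estimate, `hsENorm_tychonoff_sub_le`, serves both. For
`C'`, `D'` close to `C`, `D`, the error of `D' (C' + θ)⁻¹ P'` splits into the data error amplified
by the inverse of the last retained eigenvalue, the change of the spectral projection amplified by
the inverse gap (Davis-Kahan), and the truncation of `A` beyond the retained eigenvectors, which the
Sobolev condition controls.

In the first stage `C` is the covariance of `X^{[L]}`, `A = Ψ_L`, and `D` is the lag-one
cross-covariance. Since `ε_1` is orthogonal to the past, `D - Ψ_L C` comes only from the tail of the
`ψ_ℓ` (`hsENorm_bias_le`), and `first_stage_rate` gives the rate `K^{-β}`. In the second stage `C =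
∏∏*`, `A = -B_q`, `D = Ψ'_[q]∏*`, and the equation is exact: from index `p + q` on, the `ψ_m`
satisfy a recursion in the `β_j` alone, which reads `B_q ∏ = -Ψ'_[q]` (`rowOp_comp_blockOp`). The
data error is now the first-stage error, and the growth condition linking `M` to `K^β` turns it into
`M^{-γ}` (`second_stage_rate`). The `α̂_i` are quadratic polynomials in the `ψ̂_j` and `β̂_j` and
inherit the rate.

Only the second-order structure of the process matters. `scoreMap` represents a random vector as an
operator into `L²`, and covariances factor through it. In `ScoreSystem`, the orthogonality of `ε_k`
to the earlier `X_l` yields injective covariances, a norm bound uniform in `L`, and uniqueness of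
expansions in `X`, hence the recursion for `ψ`. Randomness enters only through
`isBigOP_of_deterministic`. -/

theorem enorm_sq_eq_ofReal {V : Type*} [NormedAddCommGroup V] (x : V) :
    ‖x‖ₑ ^ 2 = ENNReal.ofReal (‖x‖ ^ 2) := by
  rw [← ofReal_norm, ENNReal.ofReal_pow (norm_nonneg _)]

/-! ### Hilbert-Schmidt norms: triangle inequality, ideal property, Bessel bounds. -/

section HilbertSchmidt

variable {E F G : Type*}
  [NormedAddCommGroup E] [InnerProductSpace ℝ E] [CompleteSpace E]
  [NormedAddCommGroup F] [InnerProductSpace ℝ F] [CompleteSpace F]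
  [NormedAddCommGroup G] [InnerProductSpace ℝ G] [CompleteSpace G]

theorem hsENorm_sq {ι : Type*} (b : HilbertBasis ι ℝ E) (T : E →L[ℝ] F) :
    hsENorm T ^ 2 = ∑' i, ‖T (b i)‖ₑ ^ 2 := by
  rw [hsENorm_eq b, ← ENNReal.rpow_natCast, ← ENNReal.rpow_mul]
  norm_num

theorem ennreal_le_of_sq_le {a b : ℝ≥0∞} (h : a ^ 2 ≤ b ^ 2) : a ≤ b :=
  (ENNReal.pow_le_pow_left_iff two_ne_zero).1 h

theorem hsENorm_adjoint (T : E →L[ℝ] F) :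
    hsENorm (ContinuousLinearMap.adjoint T) = hsENorm T := by
  rw [hsENorm, hsENorm, tsum_sq_eq_adjoint (basis E) (basis F) T]

theorem hsENorm_zero : hsENorm (0 : E →L[ℝ] F) = 0 := by
  simp [hsENorm]

theorem hsENorm_neg (T : E →L[ℝ] F) : hsENorm (-T) = hsENorm T := by
  simp [hsENorm]

/-- Minkowski's inequality in `ℓ²` on finite sets of basis vectors, followed by a supremum over
these sets. -/
theorem hsENorm_add_le (S T : E →L[ℝ] F) : hsENorm (S + T) ≤ hsENorm S + hsENorm T := by
  have key : hsENorm (S + T) ^ 2 ≤ (hsENorm S + hsENorm T) ^ 2 := by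
    rw [hsENorm_sq (basis E)]
    refine ENNReal.summable.tsum_le_of_sum_le fun s => ?_
    have h1 := ENNReal.Lp_add_le s (fun i => ‖S (basis E i)‖ₑ) (fun i => ‖T (basis E i)‖ₑ)
      (one_le_two : (1 : ℝ) ≤ 2)
    have h2 : ∀ U : E →L[ℝ] F,
        (∑ i ∈ s, ‖U (basis E i)‖ₑ ^ (2 : ℝ)) ^ (1 / 2 : ℝ) ≤ hsENorm U := fun U => by
      refine ENNReal.rpow_le_rpow ?_ (by norm_num)
      simp_rw [ENNReal.rpow_two]
      exact ENNReal.sum_le_tsum s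
    have h3 := ENNReal.rpow_le_rpow (h1.trans (add_le_add (h2 S) (h2 T))) zero_le_two
    rw [← ENNReal.rpow_mul] at h3
    norm_num at h3
    refine le_trans (Finset.sum_le_sum fun i _ => ?_) h3
    gcongr
    exact enorm_add_le _ _
  exact ennreal_le_of_sq_le key

theorem hsENorm_sub_le (S T : E →L[ℝ] F) : hsENorm (S - T) ≤ hsENorm S + hsENorm T := by
  rw [sub_eq_add_neg, ← hsENorm_neg T]
  exact hsENorm_add_le _ _

theorem hsENorm_sum_le {ι : Type*} (s : Finset ι) (T : ι → E →L[ℝ] F) :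
    hsENorm (∑ i ∈ s, T i) ≤ ∑ i ∈ s, hsENorm (T i) := by
  classical
  induction s using Finset.induction_on with
  | empty => simp [hsENorm_zero]
  | insert i s hi ih =>
    rw [Finset.sum_insert hi, Finset.sum_insert hi]
    exact (hsENorm_add_le _ _).trans (add_le_add_right ih _)

theorem hsENorm_comp_le (A : F →L[ℝ] G) (T : E →L[ℝ] F) :
    hsENorm (A ∘L T) ≤ ‖A‖ₑ * hsENorm T := by
  refine ennreal_le_of_sq_le ?_
  rw [mul_pow, hsENorm_sq (basis E), hsENorm_sq (basis E), ← ENNReal.tsum_mul_left]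
  refine ENNReal.tsum_le_tsum fun i => ?_
  rw [← mul_pow]
  gcongr
  exact A.le_opENorm _

theorem enorm_adjoint (T : E →L[ℝ] F) : ‖ContinuousLinearMap.adjoint T‖ₑ = ‖T‖ₑ := by
  rw [← ofReal_norm, ← ofReal_norm, LinearIsometryEquiv.norm_map]

theorem hsENorm_comp_le' (A : F →L[ℝ] G) (T : E →L[ℝ] F) :
    hsENorm (A ∘L T) ≤ hsENorm A * ‖T‖ₑ := by
  rw [← hsENorm_adjoint, ContinuousLinearMap.adjoint_comp, mul_comm, ← hsENorm_adjoint A,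
    ← enorm_adjoint T]
  exact hsENorm_comp_le _ _

theorem hsENorm_smul_le (a : ℝ) (T : E →L[ℝ] F) : hsENorm (a • T) ≤ ‖a‖ₑ * hsENorm T := by
  refine ennreal_le_of_sq_le ?_
  rw [mul_pow, hsENorm_sq (basis E), hsENorm_sq (basis E), ← ENNReal.tsum_mul_left]
  refine ENNReal.tsum_le_tsum fun i => ?_
  rw [← mul_pow, smul_apply, enorm_smul]

/-- Bessel's inequality. -/
theorem tsum_inner_sq_le {ι : Type*} {e : ι → E} (he : Orthonormal ℝ e) (x : E) :
    ∑' i, ‖(inner ℝ (e i) x : ℝ)‖ₑ ^ 2 ≤ ‖x‖ₑ ^ 2 := by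
  simp_rw [enorm_sq_eq_ofReal]
  rw [← ENNReal.ofReal_tsum_of_nonneg (fun i => by positivity) (he.inner_products_summable x)]
  exact ENNReal.ofReal_le_ofReal (he.tsum_inner_products_le x)

/-- Exchanging the two sums puts the family `e` inside, where Bessel's inequality applies to each
vector `T* c_j`. -/
theorem tsum_apply_sq_eq {ι κ : Type*} (c : HilbertBasis κ ℝ F) (e : ι → E) (T : E →L[ℝ] F) :
    ∑' i, ‖T (e i)‖ₑ ^ 2 =
      ∑' j, ∑' i, ‖(inner ℝ (e i) (ContinuousLinearMap.adjoint T (c j)) : ℝ)‖ₑ ^ 2 := by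
  rw [ENNReal.tsum_comm]
  refine tsum_congr fun i => ?_
  rw [← tsum_inner_sq c]
  refine tsum_congr fun j => ?_
  rw [ContinuousLinearMap.adjoint_inner_right, real_inner_comm]

theorem tsum_apply_sq_le {ι : Type*} {e : ι → E} (he : Orthonormal ℝ e) (T : E →L[ℝ] F) :
    ∑' i, ‖T (e i)‖ₑ ^ 2 ≤ hsENorm T ^ 2 := by
  rw [tsum_apply_sq_eq (basis F), ← hsENorm_adjoint, hsENorm_sq (basis F)]
  exact ENNReal.tsum_le_tsum fun j => tsum_inner_sq_le he _

theorem enorm_apply_le_hsENorm (T : E →L[ℝ] F) (x : E) : ‖T x‖ₑ ≤ hsENorm T * ‖x‖ₑ := by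
  refine ennreal_le_of_sq_le ?_
  rw [← tsum_inner_sq (basis F) (T x), mul_pow, ← hsENorm_adjoint, hsENorm_sq (basis F),
    ← ENNReal.tsum_mul_right]
  refine ENNReal.tsum_le_tsum fun j => ?_
  rw [← ContinuousLinearMap.adjoint_inner_left, ← mul_pow]
  gcongr
  rw [← ofReal_norm, ← ofReal_norm, ← ofReal_norm, ← ENNReal.ofReal_mul (norm_nonneg _)]
  exact ENNReal.ofReal_le_ofReal (norm_inner_le_norm _ _)

theorem norm_le_of_hsENorm_le {T : E →L[ℝ] F} {t : ℝ} (ht : 0 ≤ t)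
    (h : hsENorm T ≤ ENNReal.ofReal t) : ‖T‖ ≤ t := by
  refine T.opNorm_le_bound ht fun x => ?_
  have h1 := (enorm_apply_le_hsENorm T x).trans (mul_le_mul_left h ‖x‖ₑ)
  rw [← ofReal_norm, ← ofReal_norm, ← ENNReal.ofReal_mul ht] at h1
  exact (ENNReal.ofReal_le_ofReal_iff (by positivity)).1 h1

theorem enorm_le_of_norm_le {T : E →L[ℝ] F} {t : ℝ} (h : ‖T‖ ≤ t) : ‖T‖ₑ ≤ ENNReal.ofReal t := by
  rw [← ofReal_norm]
  exact ENNReal.ofReal_le_ofReal h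

theorem hsENorm_comp_le_ofReal {A : F →L[ℝ] G} {T : E →L[ℝ] F} {a t : ℝ} (ha : ‖A‖ ≤ a)
    (hT : hsENorm T ≤ ENNReal.ofReal t) : hsENorm (A ∘L T) ≤ ENNReal.ofReal (a * t) := by
  rw [ENNReal.ofReal_mul ((norm_nonneg A).trans ha)]
  exact (hsENorm_comp_le A T).trans (mul_le_mul' (enorm_le_of_norm_le ha) hT)

theorem hsENorm_comp_le_ofReal' {A : F →L[ℝ] G} {T : E →L[ℝ] F} {a t : ℝ}
    (hA : hsENorm A ≤ ENNReal.ofReal a) (hT : ‖T‖ ≤ t) :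
    hsENorm (A ∘L T) ≤ ENNReal.ofReal (a * t) := by
  rw [ENNReal.ofReal_mul' ((norm_nonneg T).trans hT)]
  exact (hsENorm_comp_le' A T).trans (mul_le_mul' hA (enorm_le_of_norm_le hT))

theorem hsENorm_add_le_ofReal {S T : E →L[ℝ] F} {s t : ℝ} (hs : 0 ≤ s) (ht : 0 ≤ t)
    (hS : hsENorm S ≤ ENNReal.ofReal s) (hT : hsENorm T ≤ ENNReal.ofReal t) :
    hsENorm (S + T) ≤ ENNReal.ofReal (s + t) := by
  rw [ENNReal.ofReal_add hs ht]
  exact (hsENorm_add_le S T).trans (add_le_add hS hT)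

theorem hsENorm_sub_le_ofReal {S T : E →L[ℝ] F} {s t : ℝ} (hs : 0 ≤ s) (ht : 0 ≤ t)
    (hS : hsENorm S ≤ ENNReal.ofReal s) (hT : hsENorm T ≤ ENNReal.ofReal t) :
    hsENorm (S - T) ≤ ENNReal.ofReal (s + t) := by
  rw [ENNReal.ofReal_add hs ht]
  exact (hsENorm_sub_le S T).trans (add_le_add hS hT)

theorem IsHS.exists_le {T : E →L[ℝ] F} (hT : IsHS T) :
    ∃ t : ℝ, 0 ≤ t ∧ hsENorm T ≤ ENNReal.ofReal t :=
  ⟨(hsENorm T).toReal, ENNReal.toReal_nonneg, (ENNReal.ofReal_toReal hT).ge⟩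

end HilbertSchmidt

/-! ### Spectral perturbation theory and the error of the regularised inverse. -/

section EigenSystems

variable {E F G : Type*}
  [NormedAddCommGroup E] [InnerProductSpace ℝ E] [CompleteSpace E]
  [NormedAddCommGroup F] [InnerProductSpace ℝ F] [CompleteSpace F]

theorem projFirst_apply (e : ℕ → E) (k : ℕ) (x : E) :
    projFirst e k x = ∑ j ∈ Finset.range k, (inner ℝ (e j) x : ℝ) • e j := by
  simp [projFirst, tensor_apply]

theorem projFirst_apply_of_lt {e : ℕ → E} (he : Orthonormal ℝ e) {k j : ℕ} (hj : j < k) :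
    projFirst e k (e j) = e j := by
  rw [projFirst_apply, Finset.sum_eq_single j]
  · simp [he.1 j]
  · intro i _ hij
    simp [he.2 hij]
  · intro h
    exact absurd (Finset.mem_range.2 hj) h

theorem projFirst_apply_of_le {e : ℕ → E} (he : Orthonormal ℝ e) {k j : ℕ} (hj : k ≤ j) :
    projFirst e k (e j) = 0 := by
  rw [projFirst_apply]
  refine Finset.sum_eq_zero fun i hi => ?_
  have : i ≠ j := by
    have := Finset.mem_range.1 hi
    omega
  simp [he.2 this]

theorem inner_projFirst (e : ℕ → E) (k : ℕ) (x y : E) :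
    (inner ℝ (projFirst e k x) y : ℝ) =
      ∑ j ∈ Finset.range k, (inner ℝ (e j) x : ℝ) * inner ℝ (e j) y := by
  rw [projFirst_apply, sum_inner]
  simp [real_inner_smul_left]

theorem inner_projFirst_comm (e : ℕ → E) (k : ℕ) (x y : E) :
    (inner ℝ (projFirst e k x) y : ℝ) = inner ℝ x (projFirst e k y) := by
  rw [real_inner_comm _ x, inner_projFirst, inner_projFirst]
  exact Finset.sum_congr rfl fun j _ => mul_comm _ _

theorem adjoint_projFirst (e : ℕ → E) (k : ℕ) :
    ContinuousLinearMap.adjoint (projFirst e k) = projFirst e k := by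
  refine ((ContinuousLinearMap.eq_adjoint_iff _ _).2 fun x y => ?_).symm
  exact inner_projFirst_comm e k x y

theorem norm_projFirst_apply_sq {e : ℕ → E} (he : Orthonormal ℝ e) (k : ℕ) (x : E) :
    ‖projFirst e k x‖ ^ 2 = ∑ j ∈ Finset.range k, (inner ℝ (e j) x : ℝ) ^ 2 := by
  rw [← real_inner_self_eq_norm_sq, inner_projFirst]
  refine Finset.sum_congr rfl fun j hj => ?_
  rw [← inner_projFirst_comm, projFirst_apply_of_lt he (Finset.mem_range.1 hj), sq]

theorem norm_sub_projFirst_apply_sq {e : ℕ → E} (he : Orthonormal ℝ e) (k : ℕ) (x : E) :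
    ‖x - projFirst e k x‖ ^ 2 = ‖x‖ ^ 2 - ∑ j ∈ Finset.range k, (inner ℝ (e j) x : ℝ) ^ 2 := by
  have h1 : (inner ℝ x (projFirst e k x) : ℝ) =
      ∑ j ∈ Finset.range k, (inner ℝ (e j) x : ℝ) ^ 2 := by
    rw [real_inner_comm, inner_projFirst]
    exact Finset.sum_congr rfl fun j _ => (sq _).symm
  rw [norm_sub_sq_real, h1, norm_projFirst_apply_sq he]
  ring

/-- The Hilbert-Schmidt norm of an operator restricted to the span of the first vectors. -/
theorem hsENorm_comp_projFirst_sq (e : ℕ → E) (he : Orthonormal ℝ e) (k : ℕ) (A : E →L[ℝ] F) :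
    hsENorm (A ∘L projFirst e k) ^ 2 = ∑ j ∈ Finset.range k, ‖A (e j)‖ₑ ^ 2 := by
  have h4 : ∀ (y : ℝ), ‖y‖ₑ ^ 2 = ENNReal.ofReal (y ^ 2) := fun x => by
    rw [← ofReal_norm, ← ENNReal.ofReal_pow (norm_nonneg _), Real.norm_eq_abs, sq_abs]
  rw [← hsENorm_adjoint, hsENorm_sq (basis F), ContinuousLinearMap.adjoint_comp,
    adjoint_projFirst]
  simp_rw [ContinuousLinearMap.comp_apply, enorm_sq_eq_ofReal ((projFirst e k) _),
    norm_projFirst_apply_sq he]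
  simp_rw [← tsum_inner_sq (basis F), h4]
  rw [← Summable.tsum_finsetSum fun _ _ => ENNReal.summable]
  refine tsum_congr fun j => ?_
  rw [ENNReal.ofReal_sum_of_nonneg fun _ _ => sq_nonneg _]
  refine Finset.sum_congr rfl fun i _ => ?_
  rw [ContinuousLinearMap.adjoint_inner_right, real_inner_comm]

/-- Both sides equal `k - ∑_{i,j<k} ⟨e_i, f_j⟩²`; the equality of the two ranks is what makes this
symmetric. -/
theorem sum_norm_sub_projFirst_comm {e f : ℕ → E} (he : Orthonormal ℝ e) (hf : Orthonormal ℝ f)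
    (k : ℕ) :
    ∑ i ∈ Finset.range k, ‖e i - projFirst f k (e i)‖ ^ 2 =
      ∑ i ∈ Finset.range k, ‖f i - projFirst e k (f i)‖ ^ 2 := by
  simp_rw [norm_sub_projFirst_apply_sq he, norm_sub_projFirst_apply_sq hf, he.1, hf.1]
  rw [Finset.sum_sub_distrib, Finset.sum_sub_distrib, Finset.sum_comm]
  congr 1
  refine Finset.sum_congr rfl fun i _ => Finset.sum_congr rfl fun j _ => ?_
  rw [real_inner_comm]

theorem hsENorm_sub_projFirst_comp_comm {e f : ℕ → E} (he : Orthonormal ℝ e)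
    (hf : Orthonormal ℝ f) (k : ℕ) :
    hsENorm ((ContinuousLinearMap.id ℝ E - projFirst f k) ∘L projFirst e k) =
      hsENorm ((ContinuousLinearMap.id ℝ E - projFirst e k) ∘L projFirst f k) := by
  refine (ENNReal.pow_right_strictMono two_ne_zero).injective ?_
  simp only [hsENorm_comp_projFirst_sq _ he, hsENorm_comp_projFirst_sq _ hf, enorm_sq_eq_ofReal]
  rw [← ENNReal.ofReal_sum_of_nonneg fun _ _ => by positivity,
    ← ENNReal.ofReal_sum_of_nonneg fun _ _ => by positivity]
  congr 1
  simpa using sum_norm_sub_projFirst_comm he hf k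

/-- `P_f - P_e = P_f (I - P_e) - (I - P_f) P_e`. The first term is the adjoint of `(I - P_e) P_f`,
and the second has the same norm by symmetry of equal-rank projections. -/
theorem hsENorm_projFirst_sub_le {e f : ℕ → E} (he : Orthonormal ℝ e) (hf : Orthonormal ℝ f)
    (k : ℕ) :
    hsENorm (projFirst f k - projFirst e k) ≤
      2 * hsENorm ((ContinuousLinearMap.id ℝ E - projFirst e k) ∘L projFirst f k) := by
  set I := ContinuousLinearMap.id ℝ E
  have h1 : projFirst f k - projFirst e k =
      projFirst f k ∘L (I - projFirst e k) - (I - projFirst f k) ∘L projFirst e k := by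
    ext x
    simp [I]
  have h2 : hsENorm (projFirst f k ∘L (I - projFirst e k)) =
      hsENorm ((I - projFirst e k) ∘L projFirst f k) := by
    rw [← hsENorm_adjoint, ContinuousLinearMap.adjoint_comp, map_sub, adjoint_projFirst,
      adjoint_projFirst, ContinuousLinearMap.adjoint_id]
  rw [h1, two_mul]
  refine (hsENorm_sub_le _ _).trans_eq ?_
  rw [h2, hsENorm_sub_projFirst_comp_comm he hf]

variable {T : E →L[ℝ] E} {v : ℕ → ℝ} {e : ℕ → E}

theorem IsEigenSystem.apply_eigenvector (h : IsEigenSystem T v e) (j : ℕ) :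
    T (e j) = v j • e j := by
  refine (h.hasSum (e j)).unique ?_
  have h1 := hasSum_single (f := fun i => v i • tensor (e i) (e i) (e j)) j fun i hij => by
    simp [tensor_apply, h.orthonormal.2 hij]
  simpa [tensor_apply, h.orthonormal.1 j] using h1

theorem IsEigenSystem.hasSum_inner (h : IsEigenSystem T v e) (x y : E) :
    HasSum (fun j => v j * ((inner ℝ (e j) x : ℝ) * inner ℝ (e j) y)) (inner ℝ (T x) y) := by
  have h1 := (h.hasSum x).mapL (innerSL ℝ y)
  rw [innerSL_apply_apply, real_inner_comm] at h1
  refine h1.congr_fun fun j => ?_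
  rw [innerSL_apply_apply, tensor_apply, real_inner_smul_right, real_inner_smul_right,
    real_inner_comm y]

theorem IsEigenSystem.inner_comm (h : IsEigenSystem T v e) (x y : E) :
    (inner ℝ (T x) y : ℝ) = inner ℝ x (T y) := by
  rw [real_inner_comm _ x]
  refine (h.hasSum_inner x y).unique ((h.hasSum_inner y x).congr_fun fun j => ?_)
  ring

theorem IsEigenSystem.inner_nonneg (h : IsEigenSystem T v e) (x : E) :
    0 ≤ (inner ℝ (T x) x : ℝ) :=
  (h.hasSum_inner x x).nonneg fun j => mul_nonneg (h.nonneg j) (mul_self_nonneg _)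

theorem IsEigenSystem.orthogonal_eq_bot (h : IsEigenSystem T v e) (hT : Function.Injective T) :
    (Submodule.span ℝ (Set.range e))ᗮ = ⊥ := by
  rw [Submodule.eq_bot_iff]
  intro x hx
  have h1 : ∀ j, (inner ℝ (e j) x : ℝ) = 0 := fun j =>
    (Submodule.mem_orthogonal _ x).1 hx _ (Submodule.subset_span ⟨j, rfl⟩)
  refine hT ((h.hasSum x).unique ?_)
  simp [tensor_apply, h1, hasSum_zero]

/-- The eigenvectors of an injective operator as a complete orthonormal system. -/
def IsEigenSystem.hilbertBasis (h : IsEigenSystem T v e) (hT : Function.Injective T) :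
    HilbertBasis ℕ ℝ E :=
  HilbertBasis.mkOfOrthogonalEqBot h.orthonormal (h.orthogonal_eq_bot hT)

@[simp]
theorem IsEigenSystem.hilbertBasis_apply (h : IsEigenSystem T v e) (hT : Function.Injective T)
    (j : ℕ) : h.hilbertBasis hT j = e j := by
  rw [IsEigenSystem.hilbertBasis, HilbertBasis.coe_mkOfOrthogonalEqBot]

theorem IsEigenSystem.le_opNorm (h : IsEigenSystem T v e) (j : ℕ) : v j ≤ ‖T‖ := by
  have h1 := T.le_opNorm (e j)
  rw [h.apply_eigenvector, norm_smul, h.orthonormal.1, mul_one, mul_one, Real.norm_eq_abs] at h1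
  exact (le_abs_self _).trans h1

/-- One half of Weyl's inequality for the eigenvalues. -/
theorem IsEigenSystem.sub_norm_le {T' : E →L[ℝ] E} {v' : ℕ → ℝ} {e' : ℕ → E}
    (h : IsEigenSystem T v e) (h' : IsEigenSystem T' v' e') (k : ℕ) :
    v k - ‖T' - T‖ ≤ v' k := by
  -- Dimension count: `k + 1` coefficients against `k` linear conditions give a nonzero `x` in the
  -- span of `e_0, …, e_k` that is orthogonal to `e'_0, …, e'_{k-1}`. On it the form of `T` is at
  -- least `v k` and that of `T'` at most `v' k`.
  let f : (Fin (k + 1) → ℝ) →ₗ[ℝ] (Fin k → ℝ) :=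
    LinearMap.pi fun j => (innerₛₗ ℝ (e' j)) ∘ₗ
      (Fintype.linearCombination ℝ fun i : Fin (k + 1) => e i)
  have hf : f.ker ≠ ⊥ := LinearMap.ker_ne_bot_of_finrank_lt (by simp)
  obtain ⟨a, ha, ha0⟩ := Submodule.exists_mem_ne_zero_of_ne_bot hf
  set x := ∑ i : Fin (k + 1), a i • e i with hx
  have hperp : ∀ j < k, (inner ℝ (e' j) x : ℝ) = 0 := fun j hj => by
    have := congrFun (LinearMap.mem_ker.1 ha) ⟨j, hj⟩
    simpa [f, Fintype.linearCombination_apply] using this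
  have he : Orthonormal ℝ fun i : Fin (k + 1) => e i :=
    h.orthonormal.comp _ Fin.val_injective
  have hnx : ‖x‖ ^ 2 = ∑ i, a i ^ 2 := by
    rw [← real_inner_self_eq_norm_sq, hx, he.inner_sum]
    simp [sq]
  have hpos : 0 < ‖x‖ ^ 2 := by
    rw [hnx]
    obtain ⟨i, hi⟩ := Function.ne_iff.1 ha0
    exact Finset.sum_pos' (fun _ _ => sq_nonneg _) ⟨i, Finset.mem_univ _, sq_pos_of_ne_zero hi⟩
  have h1 : v k * ‖x‖ ^ 2 ≤ inner ℝ (T x) x := by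
    have : T x = ∑ i : Fin (k + 1), (v i * a i) • e i := by
      simp [hx, map_sum, h.apply_eigenvector, smul_smul, mul_comm]
    rw [this, hx, he.inner_sum, ← hx, hnx, Finset.mul_sum]
    refine Finset.sum_le_sum fun i _ => ?_
    have := h.antitone (Nat.lt_succ_iff.1 i.2)
    simp only [conj_trivial]
    nlinarith [sq_nonneg (a i)]
  have h2 : (inner ℝ (T' x) x : ℝ) ≤ v' k * ‖x‖ ^ 2 := by
    have hs := h'.hasSum_inner x x
    have hb := (h'.orthonormal.inner_products_summable x).hasSum.mul_left (v' k)
    refine (hasSum_le (fun j => ?_) hs hb).trans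
      (mul_le_mul_of_nonneg_left (h'.orthonormal.tsum_inner_products_le x) (h'.nonneg k))
    rcases lt_or_ge j k with hj | hj
    · simp [hperp j hj]
    · rw [Real.norm_eq_abs, sq_abs, ← sq]
      exact mul_le_mul_of_nonneg_right (h'.antitone hj) (sq_nonneg _)
  have h3 : (inner ℝ (T x) x : ℝ) - inner ℝ (T' x) x ≤ ‖T' - T‖ * ‖x‖ ^ 2 := by
    rw [← inner_sub_left, sq, ← mul_assoc]
    refine (real_inner_le_norm _ _).trans (mul_le_mul_of_nonneg_right ?_ (norm_nonneg _))
    have := (T' - T).le_opNorm x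
    rwa [sub_apply, norm_sub_rev] at this
  nlinarith

/-- `Ring.inverse` is zero off the units, so invertibility must be known. The form of `T + θ` is
coercive with constant `θ`, and Lax-Milgram applies. -/
theorem IsEigenSystem.isUnit_add_smul (h : IsEigenSystem T v e) {θ : ℝ} (hθ : 0 < θ) :
    IsUnit (T + θ • ContinuousLinearMap.id ℝ E) := by
  set S := T + θ • ContinuousLinearMap.id ℝ E with hS
  let B : E →L[ℝ] E →L[ℝ] ℝ := (innerSL ℝ) ∘L S
  have hB : IsCoercive B := by
    refine ⟨θ, hθ, fun u => ?_⟩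
    have := h.inner_nonneg u
    have e1 : B u u = inner ℝ (T u) u + θ * ‖u‖ ^ 2 := by
      rw [← real_inner_self_eq_norm_sq, ← real_inner_smul_left, ← inner_add_left]
      rfl
    rw [e1]
    nlinarith
  have hBS : (hB.continuousLinearEquivOfBilin : E →L[ℝ] E) = S := by
    ext x
    refine ext_inner_right ℝ fun w => ?_
    exact hB.continuousLinearEquivOfBilin_apply x w
  exact ⟨hB.continuousLinearEquivOfBilin.toUnit, hBS⟩

theorem IsEigenSystem.inverse_apply (h : IsEigenSystem T v e) {θ : ℝ} (hθ : 0 < θ) (j : ℕ) :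
    Ring.inverse (T + θ • ContinuousLinearMap.id ℝ E) (e j) = (v j + θ)⁻¹ • e j := by
  have h1 := DFunLike.congr_fun (Ring.inverse_mul_cancel _ (h.isUnit_add_smul hθ)) (e j)
  have h2 : v j + θ ≠ 0 := by
    have := h.nonneg j
    positivity
  have h3 : (T + θ • ContinuousLinearMap.id ℝ E) (e j) = (v j + θ) • e j := by
    simp [h.apply_eigenvector, add_smul]
  rw [mul_apply_eq_comp, h3, map_smul, one_apply_eq_self] at h1
  rw [← smul_right_injective E h2 |>.eq_iff]
  simp only [h1, smul_smul, mul_inv_cancel₀ h2, one_smul]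

/-- On the retained eigenvectors the eigenvalues, not `θ`, bound the inverse; hence `θ` may tend to
zero at any speed without inflating this factor. -/
theorem IsEigenSystem.norm_inverse_comp_projFirst_le (h : IsEigenSystem T v e) {θ : ℝ}
    (hθ : 0 < θ) {k : ℕ} {w : ℝ} (hw : 0 < w) (hwv : ∀ j < k, w ≤ v j) :
    ‖Ring.inverse (T + θ • ContinuousLinearMap.id ℝ E) ∘L projFirst e k‖ ≤ w⁻¹ := by
  refine ContinuousLinearMap.opNorm_le_bound _ (by positivity) fun x => ?_
  refine le_of_sq_le_sq ?_ (by positivity)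
  have h1 : (Ring.inverse (T + θ • ContinuousLinearMap.id ℝ E) ∘L projFirst e k) x =
      ∑ j ∈ Finset.range k, ((v j + θ)⁻¹ * (inner ℝ (e j) x : ℝ)) • e j := by
    rw [ContinuousLinearMap.comp_apply, projFirst_apply, map_sum]
    refine Finset.sum_congr rfl fun j _ => ?_
    rw [map_smul, h.inverse_apply hθ, smul_smul, mul_comm]
  rw [h1, ← real_inner_self_eq_norm_sq, h.orthonormal.inner_sum, mul_pow]
  have h2 := norm_sub_projFirst_apply_sq h.orthonormal k x
  have h3 : ∑ j ∈ Finset.range k, (inner ℝ (e j) x : ℝ) ^ 2 ≤ ‖x‖ ^ 2 := by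
    nlinarith [sq_nonneg ‖x - projFirst e k x‖]
  refine le_trans ?_ (mul_le_mul_of_nonneg_left h3 (by positivity))
  rw [Finset.mul_sum]
  refine Finset.sum_le_sum fun j hj => ?_
  have hj' := hwv j (Finset.mem_range.1 hj)
  rw [conj_trivial, ← sq, mul_pow]
  have h4 : 0 ≤ (v j + θ)⁻¹ := by
    have := h.nonneg j
    positivity
  gcongr
  linarith

/-- A Davis-Kahan bound for the projections onto the leading eigenvectors. -/
theorem IsEigenSystem.hsENorm_projFirst_sub_le {T' : E →L[ℝ] E} {v' : ℕ → ℝ} {e' : ℕ → E}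
    (h : IsEigenSystem T v e) (h' : IsEigenSystem T' v' e') (hT : Function.Injective T) {m : ℕ}
    {a : ℝ} (ha0 : 0 ≤ a) (ha : hsENorm (T' - T) ≤ ENNReal.ofReal a) (hgap : v (m + 1) < v m)
    (hag : a ≤ (v m - v (m + 1)) / 2) :
    hsENorm (projFirst e' (m + 1) - projFirst e (m + 1)) ≤
      ENNReal.ofReal (4 * a * (v m - v (m + 1))⁻¹) := by
  set g := v m - v (m + 1) with hg
  have hg0 : 0 < g := sub_pos.2 hgap
  have hweyl := h.sub_norm_le h' m
  have hna := norm_le_of_hsENorm_le ha0 ha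
  set I := ContinuousLinearMap.id ℝ E
  -- For `l > m ≥ i` one has `⟨e_l, (T' - T) e'_i⟩ = (v'_i - v_l) ⟨e_l, e'_i⟩`. Weyl's inequality
  -- and `a ≤ g / 2` keep `v'_i - v_l ≥ g / 2`, so only the gap of `T` is needed. The final constant
  -- 4 is this factor 2 times the 2 from comparing projections.
  have h1 : ∀ i < m + 1, ‖(I - projFirst e (m + 1)) (e' i)‖ₑ ^ 2 ≤
      ENNReal.ofReal (2 / g) ^ 2 * ‖(T' - T) (e' i)‖ₑ ^ 2 := fun i hi => by
    rw [← tsum_inner_sq (h.hilbertBasis hT), ← tsum_inner_sq (h.hilbertBasis hT),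
      ← ENNReal.tsum_mul_left]
    refine ENNReal.tsum_le_tsum fun l => ?_
    rw [← mul_pow, h.hilbertBasis_apply]
    gcongr
    have e1 : (inner ℝ (e l) ((I - projFirst e (m + 1)) (e' i)) : ℝ) =
        inner ℝ (e l) (e' i) - inner ℝ (projFirst e (m + 1) (e l)) (e' i) := by
      rw [inner_projFirst_comm, ← inner_sub_right]
      rfl
    rcases lt_or_ge l (m + 1) with hl | hl
    · rw [e1, projFirst_apply_of_lt h.orthonormal hl, sub_self]
      simp
    · rw [e1, projFirst_apply_of_le h.orthonormal hl, inner_zero_left, sub_zero]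
      have e2 : (inner ℝ (e l) ((T' - T) (e' i)) : ℝ) = (v' i - v l) * inner ℝ (e l) (e' i) := by
        rw [sub_apply, inner_sub_right, h'.apply_eigenvector,
          ← h.inner_comm, h.apply_eigenvector, real_inner_smul_left, real_inner_smul_right]
        ring
      have e3 : g / 2 ≤ v' i - v l := by
        have := h'.antitone (Nat.lt_succ_iff.1 hi)
        have := h.antitone hl
        linarith
      rw [e2, ← ofReal_norm, ← ofReal_norm, ← ENNReal.ofReal_mul (by positivity), norm_mul]
      refine ENNReal.ofReal_le_ofReal ?_
      rw [← mul_assoc]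
      refine le_mul_of_one_le_left (norm_nonneg _) ?_
      rw [Real.norm_of_nonneg (by linarith)]
      calc (1 : ℝ) = 2 / g * (g / 2) := by field_simp
        _ ≤ _ := by gcongr
  have h2 : hsENorm ((I - projFirst e (m + 1)) ∘L projFirst e' (m + 1)) ≤
      ENNReal.ofReal (2 / g) * hsENorm (T' - T) := by
    refine ennreal_le_of_sq_le ?_
    rw [hsENorm_comp_projFirst_sq _ h'.orthonormal, mul_pow]
    refine (Finset.sum_le_sum fun i hi => h1 i (Finset.mem_range.1 hi)).trans ?_
    rw [← Finset.mul_sum]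
    gcongr
    exact (ENNReal.sum_le_tsum _).trans (tsum_apply_sq_le h'.orthonormal _)
  refine (FARMA.hsENorm_projFirst_sub_le h.orthonormal h'.orthonormal _).trans ?_
  refine (mul_le_mul_right (h2.trans (mul_le_mul_right ha _)) 2).trans_eq ?_
  rw [← ENNReal.ofReal_mul (by positivity), ← ENNReal.ofReal_ofNat 2,
    ← ENNReal.ofReal_mul (by positivity)]
  congr 1
  ring

/-- The error of the regularized estimator `D' (C' + θ)⁻¹ P'` of `T`, when `D' ≈ T C`
and `C' ≈ C`. -/
theorem hsENorm_tychonoff_sub_le {C C' : E →L[ℝ] E} {v v' : ℕ → ℝ} {e e' : ℕ → E}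
    (h : IsEigenSystem C v e) (h' : IsEigenSystem C' v' e') (hC : Function.Injective C)
    (A D' : E →L[ℝ] F) {m : ℕ} {θ a b t s : ℝ} (hθ : 0 < θ) (ha0 : 0 ≤ a) (hb0 : 0 ≤ b)
    (ht0 : 0 ≤ t) (hs0 : 0 ≤ s) (ha : hsENorm (C' - C) ≤ ENNReal.ofReal a)
    (hb : hsENorm (D' - A ∘L C) ≤ ENNReal.ofReal b) (ht : hsENorm A ≤ ENNReal.ofReal t)
    (hs : hsENorm (A - A ∘L projFirst e (m + 1)) ≤ ENNReal.ofReal s)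
    (hgap : v (m + 1) < v m) (hag : a ≤ (v m - v (m + 1)) / 2) :
    hsENorm (tychonoff D' C' θ e' (m + 1) - A) ≤
      ENNReal.ofReal ((b + t * a + θ * t) * (2 * (v m)⁻¹) +
        t * (4 * a * (v m - v (m + 1))⁻¹) + s) := by
  have hv1 := h.nonneg (m + 1)
  have hvm : 0 < v m := hv1.trans_lt hgap
  have hna := norm_le_of_hsENorm_le ha0 ha
  have hnt := norm_le_of_hsENorm_le ht0 ht
  have hweyl := h.sub_norm_le h' m
  set S := C' + θ • ContinuousLinearMap.id ℝ E with hS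
  set U := Ring.inverse S ∘L projFirst e' (m + 1) with hU
  -- Weyl again: `a ≤ (v m - v (m + 1)) / 2 ≤ v m / 2`, so the retained eigenvalues of `C'` are at
  -- least `v m / 2`.
  have hUn : ‖U‖ ≤ 2 * (v m)⁻¹ := by
    have := h'.norm_inverse_comp_projFirst_le hθ (k := m + 1) (w := v m / 2) (by positivity)
      fun j hj => by
        have := h'.antitone (Nat.lt_succ_iff.1 hj)
        linarith
    rwa [inv_div, div_eq_mul_inv] at this
  have hSU : S ∘L U = projFirst e' (m + 1) := by
    rw [hU, ← ContinuousLinearMap.comp_assoc]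
    have : S ∘L Ring.inverse S = ContinuousLinearMap.id ℝ E :=
      Ring.mul_inverse_cancel _ (h'.isUnit_add_smul hθ)
    rw [this, ContinuousLinearMap.id_comp]
  -- With `S = C' + θ` and `S U = P'`, this is `D' U - A = (D' - A S) U + A (P' - P) - (A - A P)`:
  -- data error, projection error, truncation.
  have hdec : tychonoff D' C' θ e' (m + 1) - A =
      ((D' - A ∘L C) - A ∘L (C' - C) - θ • A) ∘L U +
        A ∘L (projFirst e' (m + 1) - projFirst e (m + 1)) -
          (A - A ∘L projFirst e (m + 1)) := by
    have e1 : tychonoff D' C' θ e' (m + 1) = D' ∘L U := rfl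
    have e2 : (D' - A ∘L C) - A ∘L (C' - C) - θ • A = D' - A ∘L S := by
      ext x
      simp [hS]
      abel
    rw [e1, e2, ContinuousLinearMap.sub_comp, ContinuousLinearMap.comp_assoc, hSU,
      ContinuousLinearMap.comp_sub]
    abel
  have hg0 : 0 < v m - v (m + 1) := sub_pos.2 hgap
  rw [hdec]
  refine hsENorm_sub_le_ofReal (by positivity) hs0
    (hsENorm_add_le_ofReal (by positivity) (by positivity) ?_ ?_) hs
  · refine hsENorm_comp_le_ofReal' ?_ hUn
    refine hsENorm_sub_le_ofReal (by positivity) (by positivity)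
      (hsENorm_sub_le_ofReal hb0 (by positivity) hb (hsENorm_comp_le_ofReal hnt ha)) ?_
    refine (hsENorm_smul_le θ A).trans ?_
    rw [ENNReal.ofReal_mul hθ.le, ← ofReal_norm, Real.norm_of_nonneg hθ.le]
    exact mul_le_mul_right ht _
  · exact hsENorm_comp_le_ofReal hnt (h.hsENorm_projFirst_sub_le h' hC ha0 ha hgap hag)

theorem hsENorm_sub_comp_projFirst_sq (b : HilbertBasis ℕ ℝ E) (he : ∀ j, b j = e j) (k : ℕ)
    (A : E →L[ℝ] F) :
    hsENorm (A - A ∘L projFirst e k) ^ 2 = ∑' i, ‖A (e (k + i))‖ₑ ^ 2 := by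
  have heo : Orthonormal ℝ e := by
    have := b.orthonormal
    rwa [funext he] at this
  have h1 : ∀ i, ‖(A - A ∘L projFirst e k) (b (i + k))‖ₑ ^ 2 = ‖A (e (k + i))‖ₑ ^ 2 :=
    fun i => by
      rw [he, sub_apply, ContinuousLinearMap.comp_apply,
        projFirst_apply_of_le heo (Nat.le_add_left k i), map_zero, sub_zero, add_comm]
  have h2 : ∑ i ∈ Finset.range k, ‖(A - A ∘L projFirst e k) (b i)‖ₑ ^ 2 = 0 :=
    Finset.sum_eq_zero fun i hi => by
      rw [he, sub_apply, ContinuousLinearMap.comp_apply,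
        projFirst_apply_of_lt heo (Finset.mem_range.1 hi), sub_self]
      simp
  rw [hsENorm_sq b, ← Summable.sum_add_tsum_nat_add' (k := k) ENNReal.summable, h2, zero_add]
  exact tsum_congr h1

/-- The truncation error under a Sobolev condition. -/
theorem hsENorm_sub_comp_projFirst_le (b : HilbertBasis ℕ ℝ E) (he : ∀ j, b j = e j)
    {d : ℕ → F} (f : HilbertBasis ℕ ℝ F) (hd : ∀ j, f j = d j) (A : E →L[ℝ] F) {s : ℝ}
    (hs : 0 < s) {k : ℕ} (hk : 1 ≤ k) {c : ℝ} (hc0 : 0 ≤ c)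
    (hc : sobolevSum A e d s k ≤ ENNReal.ofReal (c ^ 2)) :
    hsENorm (A - A ∘L projFirst e k) ≤ ENNReal.ofReal (c * (k : ℝ) ^ (-s)) := by
  have hk0 : (0 : ℝ) < k := by exact_mod_cast hk
  have key : ENNReal.ofReal ((k : ℝ) ^ s) ^ 2 * hsENorm (A - A ∘L projFirst e k) ^ 2 ≤
      ENNReal.ofReal c ^ 2 := by
    rw [hsENorm_sub_comp_projFirst_sq b he, ← ENNReal.ofReal_pow hc0]
    refine le_trans ?_ hc
    rw [← ENNReal.tsum_mul_left, sobolevSum]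
    refine ENNReal.tsum_le_tsum fun i => ?_
    rw [← tsum_inner_sq f, ← ENNReal.tsum_mul_left]
    refine ENNReal.tsum_le_tsum fun j => ?_
    rw [hsInner_tensor, hd, real_inner_comm, ← ofReal_norm, Real.norm_eq_abs,
      ← ENNReal.ofReal_pow (by positivity), ← ENNReal.ofReal_pow (abs_nonneg _), sq_abs,
      ← ENNReal.ofReal_mul (by positivity), mul_comm]
    refine ENNReal.ofReal_le_ofReal (mul_le_mul_of_nonneg_left ?_ (sq_nonneg _))
    -- Only the weight `i^{2s}` of the first index is used; every index beyond the truncation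
    -- contributes at least `k^{2s}`.
    have h1 : ((k : ℝ) ^ s) ^ 2 ≤ ((k + i + 1 : ℕ) : ℝ) ^ (2 * s) := by
      rw [mul_comm 2 s, Real.rpow_mul (by positivity), Real.rpow_two]
      gcongr
      linarith [(Nat.cast_nonneg i : (0 : ℝ) ≤ i)]
    have h2 : (0 : ℝ) ≤ ((j + 1 : ℕ) : ℝ) ^ (2 * s) := by positivity
    linarith
  rw [← mul_pow] at key
  have key2 := ennreal_le_of_sq_le key
  have h5 : 0 < (k : ℝ) ^ s := by positivity
  rw [Real.rpow_neg hk0.le, ENNReal.ofReal_mul hc0, ENNReal.ofReal_inv_of_pos h5,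
    ← div_eq_mul_inv, ENNReal.le_div_iff_mul_le (by simp [h5]) (by simp)]
  rwa [mul_comm]

theorem sobolevSum_anti (A : E →L[ℝ] F) (e : ℕ → E) (d : ℕ → F) (s : ℝ) (k : ℕ) :
    sobolevSum A e d s k ≤ sobolevSum A e d s 0 := by
  have := ENNReal.tsum_comp_le_tsum_of_injective (add_right_injective k) fun i : ℕ =>
    ∑' j : ℕ, ENNReal.ofReal (hsInner A (tensor (e (0 + i)) (d j)) ^ 2 *
      (1 + ((0 + i + 1 : ℕ) : ℝ) ^ (2 * s) + ((j + 1 : ℕ) : ℝ) ^ (2 * s)))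
  simpa only [sobolevSum, Function.comp_def, zero_add] using this

/-- `sup_{j ≤ k} (v_j - v_{j+1})⁻¹` dominates each of its members. -/
theorem inv_sub_le_gapSup (v : ℕ → ℝ) {j k : ℕ} (hj : j < k) :
    (v j - v (j + 1))⁻¹ ≤ gapSup v k :=
  le_ciSup (f := fun i : Fin k => (v i - v (i + 1))⁻¹) (Set.finite_range _).bddAbove ⟨j, hj⟩

end EigenSystems

/-! ### Block operators on `H^n` and the plug-in maps for `B` and `α`. -/

section BlockOperators

variable {H E F G : Type*} [NormedAddCommGroup H] [InnerProductSpace ℝ H] [CompleteSpace H]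
  [NormedAddCommGroup E] [InnerProductSpace ℝ E] [CompleteSpace E]
  [NormedAddCommGroup F] [InnerProductSpace ℝ F] [CompleteSpace F]
  [NormedAddCommGroup G] [InnerProductSpace ℝ G] [CompleteSpace G]

/-- The row `(A 0 ⋯ A (n-1)) : H^n → G`. -/
def rowMap {n : ℕ} (A : Fin n → H →L[ℝ] G) : HPow H n →L[ℝ] G :=
  ∑ i, A i ∘L PiLp.proj 2 (fun _ : Fin n => H) i

theorem rowOp_eq_rowMap {n : ℕ} (A : Fin n → H →L[ℝ] H) : rowOp A = rowMap A := rfl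

theorem rowMap_apply {n : ℕ} (A : Fin n → H →L[ℝ] G) (x : HPow H n) :
    rowMap A x = ∑ i, A i (x i) := by
  simp [rowMap]

theorem adjoint_rowMap_apply {n : ℕ} (A : Fin n → H →L[ℝ] G) (y : G) :
    ContinuousLinearMap.adjoint (rowMap A) y =
      WithLp.toLp 2 fun i => ContinuousLinearMap.adjoint (A i) y := by
  refine ext_inner_left ℝ fun x => ?_
  rw [ContinuousLinearMap.adjoint_inner_right, rowMap_apply, sum_inner, PiLp.inner_apply]
  simp [ContinuousLinearMap.adjoint_inner_right]

theorem enorm_hPow_sq {n : ℕ} (x : HPow H n) : ‖x‖ₑ ^ 2 = ∑ i, ‖x i‖ₑ ^ 2 := by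
  simp_rw [enorm_sq_eq_ofReal]
  rw [PiLp.norm_sq_eq_of_L2, ENNReal.ofReal_sum_of_nonneg fun _ _ => by positivity]

/-- Exact additivity over blocks, read off from the adjoint `y ↦ (A_i* y)_i`. It keeps `‖Ψ_L‖`
bounded in `L` and makes the score operator of `X^{[L]}` grow only like `√L`. -/
theorem hsENorm_rowMap_sq {n : ℕ} (A : Fin n → H →L[ℝ] G) :
    hsENorm (rowMap A) ^ 2 = ∑ i, hsENorm (A i) ^ 2 := by
  rw [← hsENorm_adjoint, hsENorm_sq (basis G)]
  simp_rw [adjoint_rowMap_apply, enorm_hPow_sq]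
  rw [Summable.tsum_finsetSum fun _ _ => ENNReal.summable]
  refine Finset.sum_congr rfl fun i _ => ?_
  rw [← hsENorm_adjoint, hsENorm_sq (basis G)]

theorem embed_apply {n : ℕ} (i j : Fin n) (x : H) : embed i x j = if j = i then x else 0 := by
  simp [embed]

theorem norm_embed_le {n : ℕ} (i : Fin n) : ‖(embed i : H →L[ℝ] HPow H n)‖ ≤ 1 := by
  refine ContinuousLinearMap.opNorm_le_bound _ zero_le_one fun x => ?_
  refine le_of_sq_le_sq ?_ (by positivity)
  rw [PiLp.norm_sq_eq_of_L2, one_mul, Finset.sum_eq_single i]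
  · simp [embed_apply]
  · intro j _ hj
    simp [embed_apply, hj]
  · simp

theorem norm_proj_le {n : ℕ} (i : Fin n) : ‖PiLp.proj 2 (𝕜 := ℝ) (fun _ : Fin n => H) i‖ ≤ 1 := by
  refine ContinuousLinearMap.opNorm_le_bound _ zero_le_one fun x => ?_
  rw [one_mul]
  exact PiLp.norm_apply_le x i

theorem component_sub {n : ℕ} (A B : HPow H n →L[ℝ] H) (j : ℕ) :
    component A j - component B j = component (A - B) j := by
  unfold component
  split_ifs
  · rw [ContinuousLinearMap.sub_comp]
  · exact sub_zero 0

theorem hsENorm_component_le {n : ℕ} (A : HPow H n →L[ℝ] H) (j : ℕ) :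
    hsENorm (component A j) ≤ hsENorm A := by
  unfold component
  split_ifs with hj
  · have h1 := enorm_le_of_norm_le (norm_embed_le (H := H) (⟨j - 1, by omega⟩ : Fin n))
    rw [ENNReal.ofReal_one] at h1
    calc _ ≤ hsENorm A * ‖(embed ⟨j - 1, by omega⟩ : H →L[ℝ] HPow H n)‖ₑ := hsENorm_comp_le' A _
      _ ≤ hsENorm A * 1 := mul_le_mul_right h1 _
      _ = hsENorm A := mul_one _
  · simp [hsENorm_zero]

/-- The crude factor `n` is harmless: it is applied with the fixed number `q` of blocks. -/
theorem hsENorm_rowOp_le {n : ℕ} (A : Fin n → H →L[ℝ] H) {a : ℝ}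
    (hA : ∀ i, hsENorm (A i) ≤ ENNReal.ofReal a) :
    hsENorm (rowOp A) ≤ ENNReal.ofReal (n * a) := by
  refine (hsENorm_sum_le _ _).trans ?_
  refine (Finset.sum_le_sum fun i _ => (hsENorm_comp_le' (A i) _).trans
    (mul_le_mul' (hA i) (enorm_le_of_norm_le (norm_proj_le i)))).trans_eq ?_
  rw [ENNReal.ofReal_mul (by positivity)]
  simp

theorem hsENorm_ofRows_le {m n : ℕ} (R : Fin m → HPow H n →L[ℝ] H) {a : ℝ}
    (hR : ∀ i, hsENorm (R i) ≤ ENNReal.ofReal a) :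
    hsENorm (ofRows R) ≤ ENNReal.ofReal (m * a) := by
  refine (hsENorm_sum_le _ _).trans ?_
  refine (Finset.sum_le_sum fun i _ => (hsENorm_comp_le _ (R i)).trans
    (mul_le_mul' (enorm_le_of_norm_le (norm_embed_le i)) (hR i))).trans_eq ?_
  rw [ENNReal.ofReal_mul (by positivity)]
  simp

theorem psiRow_sub (ψ ψ' : ℕ → H →L[ℝ] H) (p q i : ℕ) :
    psiRow ψ p q i - psiRow ψ' p q i = psiRow (ψ - ψ') p q i := by
  ext x
  simp [psiRow, rowOp_apply]

theorem blockOp_sub (ψ ψ' : ℕ → H →L[ℝ] H) (p q : ℕ) :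
    blockOp ψ p q - blockOp ψ' p q = blockOp (ψ - ψ') p q := by
  ext x i
  simp [blockOp, ofRows_apply, ← psiRow_sub]

/-- The indices `p + q + i - 1 - b` with `b < q` and `i ≤ q` lie between `p + i ≥ 1` and `p + 2q -
1`, so the natural-number subtractions do not truncate. -/
theorem hsENorm_psiRow_sub_le {ψ ψ' : ℕ → H →L[ℝ] H} {p q i : ℕ} (hp : 1 ≤ p) (hi : i ≤ q)
    {a : ℝ} (h : ∀ j, 1 ≤ j → j ≤ p + 2 * q → hsENorm (ψ' j - ψ j) ≤ ENNReal.ofReal a) :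
    hsENorm (psiRow ψ' p q i - psiRow ψ p q i) ≤ ENNReal.ofReal (q * a) := by
  rw [psiRow_sub]
  exact hsENorm_rowOp_le _ fun b => h _ (by omega) (by omega)

theorem hsENorm_blockOp_sub_le {ψ ψ' : ℕ → H →L[ℝ] H} {p q : ℕ} (hp : 1 ≤ p)
    {a : ℝ} (h : ∀ j, 1 ≤ j → j ≤ p + 2 * q → hsENorm (ψ' j - ψ j) ≤ ENNReal.ofReal a) :
    hsENorm (blockOp ψ' p q - blockOp ψ p q) ≤ ENNReal.ofReal (q * (q * a)) := by
  rw [blockOp_sub]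
  refine hsENorm_ofRows_le _ fun b => ?_
  rw [← psiRow_sub]
  exact hsENorm_psiRow_sub_le hp (by omega) h

theorem norm_le_add_of_hsENorm_sub_le {A A' : E →L[ℝ] F} {x : ℝ} (hx : 0 ≤ x)
    (h : hsENorm (A' - A) ≤ ENNReal.ofReal x) : ‖A'‖ ≤ ‖A‖ + x := by
  have h1 := norm_le_of_hsENorm_le hx h
  have h2 := norm_add_le A (A' - A)
  rw [add_sub_cancel] at h2
  linarith

theorem hsENorm_comp_sub_comp_le {A A' : F →L[ℝ] G} {B B' : E →L[ℝ] F} {x y : ℝ}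
    (hx : 0 ≤ x) (hy : 0 ≤ y) (hA : hsENorm (A' - A) ≤ ENNReal.ofReal x)
    (hB : hsENorm (B' - B) ≤ ENNReal.ofReal y) :
    hsENorm (A' ∘L B' - A ∘L B) ≤ ENNReal.ofReal (x * (‖B‖ + y) + ‖A‖ * y) := by
  have h1 : A' ∘L B' - A ∘L B = (A' - A) ∘L B' + A ∘L (B' - B) := by
    rw [ContinuousLinearMap.sub_comp, ContinuousLinearMap.comp_sub]
    abel
  rw [h1]
  exact hsENorm_add_le_ofReal (by positivity) (by positivity)
    (hsENorm_comp_le_ofReal' hA (norm_le_add_of_hsENorm_sub_le hy hB))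
    (hsENorm_comp_le_ofReal le_rfl hB)

theorem hsENorm_comp_adjoint_sub_le {A A' : F →L[ℝ] G} {B B' : F →L[ℝ] E} {x y : ℝ}
    (hx : 0 ≤ x) (hy : 0 ≤ y) (hA : hsENorm (A' - A) ≤ ENNReal.ofReal x)
    (hB : hsENorm (B' - B) ≤ ENNReal.ofReal y) :
    hsENorm (A' ∘L ContinuousLinearMap.adjoint B' - A ∘L ContinuousLinearMap.adjoint B) ≤
      ENNReal.ofReal (x * (‖B‖ + y) + ‖A‖ * y) := by
  have h := hsENorm_comp_sub_comp_le (A := A) (A' := A') (B := ContinuousLinearMap.adjoint B)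
    (B' := ContinuousLinearMap.adjoint B') hx hy hA (by rwa [← map_sub, hsENorm_adjoint])
  rwa [LinearIsometryEquiv.norm_map] at h

/-- `ker ∏∏* = ker ∏* = (ran ∏)^⊥ = 0`. -/
theorem blockGram_injective {ψ : ℕ → H →L[ℝ] H} {p q : ℕ} (h : DenseRange (blockOp ψ p q)) :
    Function.Injective (blockGram ψ p q) := by
  rw [injective_iff_map_eq_zero]
  intro x hx
  have h1 : ContinuousLinearMap.adjoint (blockOp ψ p q) x = 0 := by
    rw [← inner_self_eq_zero (𝕜 := ℝ), ContinuousLinearMap.adjoint_inner_left]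
    have : blockOp ψ p q (ContinuousLinearMap.adjoint (blockOp ψ p q) x) = 0 := hx
    rw [this, inner_zero_right]
  have h2 : ∀ y, (inner ℝ x y : ℝ) = 0 := fun y => by
    refine h.induction_on y (isClosed_eq (by fun_prop) continuous_const) fun z => ?_
    rw [← ContinuousLinearMap.adjoint_inner_left, h1, inner_zero_left]
  exact inner_self_eq_zero.1 (h2 x)

theorem sum_fin_eq_sum_Icc {V : Type*} [AddCommMonoid V] (f : ℕ → V) (n : ℕ) :
    ∑ i : Fin n, f (i + 1) = ∑ j ∈ Finset.Icc 1 n, f j := by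
  rw [Fin.sum_univ_eq_sum_range fun i => f (i + 1), Finset.range_eq_Ico, Finset.sum_Ico_add']
  rfl

/-- If `ψ` solves the recursion of the inverted representation, then `B ∏ = - Ψ'_[q]`. -/
theorem rowOp_comp_blockOp {β ψ : ℕ → H →L[ℝ] H} {p q : ℕ} (hp : 1 ≤ p)
    (hrec : ∀ m, p + q ≤ m → ψ m = -∑ j ∈ Finset.Icc 1 q, β j ∘L ψ (m - j)) :
    (rowOp fun j : Fin q => β (j + 1)) ∘L blockOp ψ p q = -psiRow ψ p q q := by
  ext x
  rw [ContinuousLinearMap.comp_apply, rowOp_apply]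
  simp only [blockOp, ofRows_apply, psiRow, rowOp_apply, neg_apply, map_sum]
  rw [Finset.sum_comm, ← Finset.sum_neg_distrib]
  refine Finset.sum_congr rfl fun b _ => ?_
  -- Column `b` is the recursion at order `p + 2q - 1 - b`, which is at least `p + q` because `b ≤ q
  -- - 1`.
  rw [hrec (p + q + q - 1 - b) (by omega), neg_apply, neg_neg, sum_apply, ← sum_fin_eq_sum_Icc
    fun j => (β j ∘L ψ (p + q + q - 1 - b - j)) (x b)]
  refine Finset.sum_congr rfl fun a _ => ?_
  have : p + q + (q - 1 - a) - 1 - b = p + q + q - 1 - b - (a + 1) := by omega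
  rw [this]
  rfl

/-- `hsENorm_tychonoff_sub_le` with `C = ∏∏*` and target `-B`; there is no bias, because `hB` gives
`(-B)∏∏* = Ψ'_[q]∏*`. The constant `κ` dominates the Lipschitz constants of both `∏∏*` and
`Ψ'_[q]∏*` in `ψ`, the quadratic remainder being absorbed through `a ≤ 1`. -/
theorem hsENorm_bHat_sub_le {ψ ψ' : ℕ → H →L[ℝ] H} {p q : ℕ} (hp : 1 ≤ p)
    (hdense : DenseRange (blockOp ψ p q)) {ζ ζ' : ℕ → ℝ} {h h' : ℕ → HPow H q}
    (hh : IsEigenSystem (blockGram ψ p q) ζ h) (hh' : IsEigenSystem (blockGram ψ' p q) ζ' h')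
    {B : HPow H q →L[ℝ] H} (hB : B ∘L blockOp ψ p q = -psiRow ψ p q q)
    {m : ℕ} {γ a t s : ℝ} (hγ : 0 < γ) (ha0 : 0 ≤ a) (ha1 : a ≤ 1) (ht0 : 0 ≤ t) (hs0 : 0 ≤ s)
    (ha : ∀ j, 1 ≤ j → j ≤ p + 2 * q → hsENorm (ψ' j - ψ j) ≤ ENNReal.ofReal a)
    (ht : hsENorm B ≤ ENNReal.ofReal t)
    (hs : hsENorm (B - B ∘L projFirst h (m + 1)) ≤ ENNReal.ofReal s)
    (hgap : ζ (m + 1) < ζ m) {κ : ℝ}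
    (hκ : κ = (q * q + q) * (‖blockOp ψ p q‖ + ‖psiRow ψ p q q‖ + q * q) +
      (‖blockOp ψ p q‖ + ‖psiRow ψ p q q‖) * (q * q))
    (hag : κ * a ≤ (ζ m - ζ (m + 1)) / 2) :
    hsENorm (bHat ψ' p q (m + 1) γ h' - B) ≤
      ENNReal.ofReal ((κ * a + t * (κ * a) + γ * t) * (2 * (ζ m)⁻¹) +
        t * (4 * (κ * a) * (ζ m - ζ (m + 1))⁻¹) + s) := by
  set P := blockOp ψ p q with hP
  set P' := blockOp ψ' p q with hP'
  set R := psiRow ψ p q q with hR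
  set R' := psiRow ψ' p q q with hR'
  have hPd : hsENorm (P' - P) ≤ ENNReal.ofReal (q * (q * a)) := hsENorm_blockOp_sub_le hp ha
  have hRd : hsENorm (R' - R) ≤ ENNReal.ofReal (q * a) := hsENorm_psiRow_sub_le hp le_rfl ha
  have hqa : (q : ℝ) * (q * a) ≤ q * q := by
    rw [← mul_assoc]
    exact mul_le_of_le_one_right (by positivity) ha1
  have hκ0 : 0 ≤ κ := by
    rw [hκ]
    positivity
  have h1 : hsENorm (blockGram ψ' p q - blockGram ψ p q) ≤ ENNReal.ofReal (κ * a) := by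
    refine (hsENorm_comp_adjoint_sub_le (by positivity) (by positivity) hPd hPd).trans
      (ENNReal.ofReal_le_ofReal ?_)
    calc _ ≤ q * (q * a) * (‖P‖ + q * q) + ‖P‖ * (q * (q * a)) := by gcongr
      _ ≤ q * (q * a) * (‖P‖ + q * q) + ‖P‖ * (q * (q * a)) +
          (q * a * (‖P‖ + q * q) + (q * q + q + q * q) * a * ‖R‖) :=
        le_add_of_nonneg_right (by positivity)
      _ = κ * a := by rw [hκ]; ring
  have h2 : hsENorm (R' ∘L ContinuousLinearMap.adjoint P' - (-B) ∘L blockGram ψ p q) ≤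
      ENNReal.ofReal (κ * a) := by
    have e1 : (-B) ∘L blockGram ψ p q = R ∘L ContinuousLinearMap.adjoint P := by
      rw [blockGram, ← ContinuousLinearMap.comp_assoc, ContinuousLinearMap.neg_comp, ← hP, hB,
        neg_neg]
    rw [e1]
    refine (hsENorm_comp_adjoint_sub_le (by positivity) (by positivity) hRd hPd).trans
      (ENNReal.ofReal_le_ofReal ?_)
    calc _ ≤ q * a * (‖P‖ + q * q) + ‖R‖ * (q * (q * a)) := by gcongr
      _ ≤ q * a * (‖P‖ + q * q) + ‖R‖ * (q * (q * a)) +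
          (q * q * a * (‖P‖ + q * q) + (q * q + q) * a * ‖R‖ + ‖P‖ * (q * q) * a) :=
        le_add_of_nonneg_right (by positivity)
      _ = κ * a := by rw [hκ]; ring
  have h3 := hsENorm_tychonoff_sub_le hh hh' (blockGram_injective hdense) (-B)
    (R' ∘L ContinuousLinearMap.adjoint P') hγ (by positivity) (by positivity) ht0 hs0 h1 h2
    (by rwa [hsENorm_neg])
    (by rwa [ContinuousLinearMap.neg_comp, ← neg_sub', hsENorm_neg]) hgap hag
  have e2 : bHat ψ' p q (m + 1) γ h' - B = -(tychonoff (R' ∘L ContinuousLinearMap.adjoint P')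
      (blockGram ψ' p q) γ h' (m + 1) - -B) := by
    rw [bHat]
    abel
  rwa [e2, hsENorm_neg]

/-- The map is quadratic in `(ψ, B)`, hence Lipschitz near a bounded point. Each product costs at
most `(t + 1)(a + b)`, using `a ≤ 1`, and there are at most `n` of them. -/
theorem hsENorm_alphaHat_sub_le {ψ ψ' : ℕ → H →L[ℝ] H} {q i n : ℕ} {B B' : HPow H q →L[ℝ] H}
    (hi1 : 1 ≤ i) (hin : i ≤ n) {a b t : ℝ} (ha0 : 0 ≤ a) (ha1 : a ≤ 1) (hb0 : 0 ≤ b)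
    (ht0 : 0 ≤ t) (ha : ∀ j, 1 ≤ j → j ≤ n → hsENorm (ψ' j - ψ j) ≤ ENNReal.ofReal a)
    (hb : hsENorm (B' - B) ≤ ENNReal.ofReal b)
    (hψ : ∀ j, 1 ≤ j → j ≤ n → ‖ψ j‖ ≤ t) (hB : hsENorm B ≤ ENNReal.ofReal t) :
    hsENorm (alphaHat ψ' B' i - alphaHat ψ B i) ≤
      ENNReal.ofReal ((1 + n * (t + 1)) * (a + b)) := by
  have hcomp : ∀ j, hsENorm (component B' j - component B j) ≤ ENNReal.ofReal b := fun j => by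
    rw [component_sub]
    exact (hsENorm_component_le _ _).trans hb
  have hnB : ∀ j, ‖component B j‖ ≤ t := fun j =>
    norm_le_of_hsENorm_le ht0 ((hsENorm_component_le _ _).trans hB)
  have hdec : alphaHat ψ' B' i - alphaHat ψ B i =
      ((ψ' i - ψ i) - (component B' i - component B i)) + ∑ j ∈ Finset.Icc 1 (i - 1),
        (component B' j ∘L ψ' (i - j) - component B j ∘L ψ (i - j)) := by
    rw [alphaHat, alphaHat, Finset.sum_sub_distrib]
    abel
  have hterm : ∀ j ∈ Finset.Icc 1 (i - 1),
      hsENorm (component B' j ∘L ψ' (i - j) - component B j ∘L ψ (i - j)) ≤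
        ENNReal.ofReal ((t + 1) * (a + b)) := fun j hj => by
    rw [Finset.mem_Icc] at hj
    refine (hsENorm_comp_sub_comp_le hb0 ha0 (hcomp j)
      (ha (i - j) (by omega) (by omega))).trans (ENNReal.ofReal_le_ofReal ?_)
    have h1 := hψ (i - j) (by omega) (by omega)
    calc b * (‖ψ (i - j)‖ + a) + ‖component B j‖ * a ≤ b * (t + 1) + t * a := by
          gcongr
          exact hnB j
      _ ≤ _ := by nlinarith
  have hsum : hsENorm (∑ j ∈ Finset.Icc 1 (i - 1),
      (component B' j ∘L ψ' (i - j) - component B j ∘L ψ (i - j))) ≤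
        ENNReal.ofReal (n * ((t + 1) * (a + b))) := by
    refine (hsENorm_sum_le _ _).trans ((Finset.sum_le_sum hterm).trans ?_)
    rw [Finset.sum_const, nsmul_eq_mul, ENNReal.ofReal_mul (Nat.cast_nonneg n),
      ENNReal.ofReal_natCast, Nat.card_Icc]
    gcongr
    omega
  rw [hdec]
  refine (hsENorm_add_le_ofReal (by positivity) (by positivity)
    (hsENorm_sub_le_ofReal ha0 hb0 (ha i hi1 hin) (hcomp i)) hsum).trans_eq ?_
  congr 1
  ring

end BlockOperators

/-! ### Random vectors as operators into `L²`. -/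

section Scores

variable {Ω : Type*} [MeasurableSpace Ω] {μ : Measure Ω}
  {E F : Type*}
  [NormedAddCommGroup E] [InnerProductSpace ℝ E] [CompleteSpace E]
  [NormedAddCommGroup F] [InnerProductSpace ℝ F] [CompleteSpace F]

/-- The operator `x ↦ ⟨x, X⟩` from `E` to the square integrable real random variables. -/
def scoreMap {X : Ω → E} (hX : MemLp X 2 μ) : E →L[ℝ] Lp ℝ 2 μ :=
  LinearMap.mkContinuous
    { toFun := fun x => (innerSL ℝ x).compLp (hX.toLp X)
      map_add' := fun x y => by rw [map_add, ContinuousLinearMap.add_compLp]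
      map_smul' := fun a x => by
        rw [map_smulₛₗ, ContinuousLinearMap.smul_compLp]
        rfl }
    ‖hX.toLp X‖ fun x => by
      refine (ContinuousLinearMap.norm_compLp_le _ _).trans_eq ?_
      rw [innerSL_apply_norm, mul_comm]

theorem scoreMap_coeFn {X : Ω → E} (hX : MemLp X 2 μ) (x : E) :
    scoreMap hX x =ᵐ[μ] fun ω => inner ℝ x (X ω) := by
  refine ((innerSL ℝ x).coeFn_compLp' (hX.toLp X)).trans ?_
  filter_upwards [hX.coeFn_toLp] with ω hω
  rw [hω, innerSL_apply_apply]

theorem inner_scoreMap {X : Ω → E} {Y : Ω → F} (hX : MemLp X 2 μ) (hY : MemLp Y 2 μ) (x : E)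
    (y : F) :
    (inner ℝ (scoreMap hX x) (scoreMap hY y) : ℝ) =
      ∫ ω, (inner ℝ x (X ω) : ℝ) * inner ℝ y (Y ω) ∂μ := by
  rw [L2.inner_def]
  refine integral_congr_ae ?_
  filter_upwards [scoreMap_coeFn hX x, scoreMap_coeFn hY y] with ω h1 h2
  rw [h1, h2, real_inner_comm]
  simp

theorem norm_scoreMap_sq {X : Ω → E} (hX : MemLp X 2 μ) (x : E) :
    ‖scoreMap hX x‖ ^ 2 = ∫ ω, (inner ℝ x (X ω) : ℝ) ^ 2 ∂μ := by
  rw [← real_inner_self_eq_norm_sq, inner_scoreMap]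
  simp_rw [sq]

theorem continuous_tensor : Continuous fun z : E × F => tensor z.1 z.2 := by
  have h := (InnerProductSpace.rankOne ℝ : F →L[ℝ] E →L⋆[ℝ] E →L[ℝ] F).continuous
  exact (h.comp continuous_snd).clm_apply continuous_fst

theorem norm_tensor (x : E) (y : F) : ‖tensor x y‖ = ‖x‖ * ‖y‖ := by
  rw [tensor, InnerProductSpace.norm_rankOne, mul_comm]

theorem integrable_tensor {X : Ω → E} {Y : Ω → F} (hX : MemLp X 2 μ) (hY : MemLp Y 2 μ) :
    Integrable (fun ω => tensor (X ω) (Y ω)) μ := by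
  have hi : Integrable (fun ω => ‖X ω‖ * ‖Y ω‖) μ := hX.norm.integrable_mul hY.norm
  have hm := Continuous.comp_aestronglyMeasurable (g := fun z : E × F => tensor z.1 z.2)
    (f := fun ω => (X ω, Y ω)) continuous_tensor (hX.1.prodMk hY.1)
  exact Integrable.mono' hi hm (Eventually.of_forall fun ω => (norm_tensor _ _).le)

theorem inner_crossCov {X : Ω → E} {Y : Ω → F} (hX : MemLp X 2 μ) (hY : MemLp Y 2 μ)
    (hX0 : ∫ ω, X ω ∂μ = 0) (hY0 : ∫ ω, Y ω ∂μ = 0) (x : E) (y : F) :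
    (inner ℝ (crossCov μ X Y x) y : ℝ) = inner ℝ (scoreMap hX x) (scoreMap hY y) := by
  rw [inner_scoreMap, crossCov, hX0, hY0]
  simp only [sub_zero]
  have hi := integrable_tensor hX hY
  have hi' : Integrable (fun ω => tensor (X ω) (Y ω) x) μ :=
    (ContinuousLinearMap.apply ℝ F x).integrable_comp hi
  rw [ContinuousLinearMap.integral_apply hi, real_inner_comm, ← integral_inner hi']
  refine integral_congr_ae (Eventually.of_forall fun ω => ?_)
  simp only [tensor_apply, real_inner_smul_right]
  rw [real_inner_comm]

/-- This factorisation turns statements about covariances into operator algebra: injectivity, norm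
bounds and the bias are all read off from the score operators. -/
theorem crossCov_eq {X : Ω → E} {Y : Ω → F} (hX : MemLp X 2 μ) (hY : MemLp Y 2 μ)
    (hX0 : ∫ ω, X ω ∂μ = 0) (hY0 : ∫ ω, Y ω ∂μ = 0) :
    crossCov μ X Y = ContinuousLinearMap.adjoint (scoreMap hY) ∘L scoreMap hX := by
  ext x
  refine ext_inner_right ℝ fun y => ?_
  rw [inner_crossCov hX hY hX0 hY0, ContinuousLinearMap.comp_apply,
    ContinuousLinearMap.adjoint_inner_left]

/-- Bessel's inequality for `X ω`, integrated over `ω`. -/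
theorem isHS_scoreMap {X : Ω → E} (hX : MemLp X 2 μ) : IsHS (scoreMap hX) := by
  have key : hsENorm (scoreMap hX) ^ 2 ≤ ENNReal.ofReal (∫ ω, ‖X ω‖ ^ 2 ∂μ) := by
    rw [hsENorm_sq (basis E)]
    refine ENNReal.summable.tsum_le_of_sum_le fun s => ?_
    simp_rw [enorm_sq_eq_ofReal, norm_scoreMap_sq]
    rw [← ENNReal.ofReal_sum_of_nonneg fun i _ => integral_nonneg fun ω => sq_nonneg _]
    refine ENNReal.ofReal_le_ofReal ?_
    have hi : ∀ i ∈ s, Integrable (fun ω => (inner ℝ (basis E i) (X ω) : ℝ) ^ 2) μ :=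
      fun i _ => (hX.const_inner _).integrable_sq
    rw [← integral_finsetSum _ hi]
    refine integral_mono (integrable_finsetSum _ hi) hX.norm.integrable_sq fun ω => ?_
    have := (basis E).orthonormal.sum_inner_products_le (X ω) (s := s)
    simpa using this
  intro htop
  rw [htop] at key
  simp at key

/-- Almost sure convergence identifies the sum of an absolutely convergent series. -/
theorem hasSum_Lp_of_ae {f : ℕ → Lp ℝ 2 μ} {g : Lp ℝ 2 μ} (hf : Summable fun n => ‖f n‖)
    (h : ∀ᵐ ω ∂μ, HasSum (fun n => f n ω) (g ω)) : HasSum f g := by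
  have h1 : ∑' n, ‖f n‖ₑ ≠ ⊤ := by
    simp_rw [← ofReal_norm]
    exact hf.tsum_ofReal_ne_top
  have h2 : ∑' n, f n = g := by
    refine Lp.ext ?_
    filter_upwards [h, Lp.hasSum_coeFn_tsum h1] with ω e1 e2
    exact e2.unique e1
  exact h2 ▸ hf.of_norm.hasSum

end Scores

/-! ### Consequences of causality and invertibility in `L²`. -/

/-- The second order structure of a causal and invertible process, in terms of the operators
`x ↦ ⟨x, X_k⟩` and `x ↦ ⟨x, ε_k⟩`. -/
structure ScoreSystem {H G : Type*} [NormedAddCommGroup H] [InnerProductSpace ℝ H]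
    [CompleteSpace H] [NormedAddCommGroup G] [InnerProductSpace ℝ G]
    (X ε : ℤ → H →L[ℝ] G) (φ ψ : ℕ → H →L[ℝ] H) : Prop where
  orthogonal : ∀ k l, k ≠ l → ∀ x y, (inner ℝ (ε k x) (ε l y) : ℝ) = 0
  norm_noise : ∀ k x, ‖ε k x‖ = ‖ε 0 x‖
  injective : ∀ x, ε 0 x = 0 → x = 0
  norm_process : ∀ k x, ‖X k x‖ = ‖X 0 x‖
  summable_causal : Summable fun j : ℕ => ‖φ (j + 1)‖
  summable_inverse : Summable fun j : ℕ => ‖ψ (j + 1)‖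
  causal : ∀ k x, HasSum (fun j : ℕ => ε (k - (j + 1 : ℕ))
    (ContinuousLinearMap.adjoint (φ (j + 1)) x)) (X k x - ε k x)
  inverse : ∀ k x, HasSum (fun j : ℕ => X (k - (j + 1 : ℕ))
    (ContinuousLinearMap.adjoint (ψ (j + 1)) x)) (X k x - ε k x)

theorem sum_range_succ_eq_add_sum_Icc {V : Type*} [AddCommMonoid V] (f : ℕ → V) (n : ℕ) :
    ∑ i ∈ Finset.range (n + 1), f i = f 0 + ∑ i ∈ Finset.Icc 1 n, f i := by
  rw [Finset.sum_range_succ', add_comm, ← sum_fin_eq_sum_Icc, Finset.sum_range]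

namespace ScoreSystem

variable {H G : Type*} [NormedAddCommGroup H] [InnerProductSpace ℝ H]
    [CompleteSpace H] [NormedAddCommGroup G] [InnerProductSpace ℝ G] [CompleteSpace G]
    {X ε : ℤ → H →L[ℝ] G} {φ ψ : ℕ → H →L[ℝ] H}

/-- By causality `X_l - ε_l` is a series in the noise strictly before `l ≤ k`, which is orthogonal
to `ε_k`. -/
theorem inner_noise_sub (S : ScoreSystem X ε φ ψ) {k l : ℤ} (hkl : l ≤ k) (x y : H) :
    (inner ℝ (ε k x) (X l y) : ℝ) = inner ℝ (ε k x) (ε l y) := by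
  have h1 := (S.causal l y).mapL (innerSL ℝ (ε k x))
  have h2 : ∀ j : ℕ, innerSL ℝ (ε k x) (ε (l - (j + 1 : ℕ))
      (ContinuousLinearMap.adjoint (φ (j + 1)) y)) = 0 := fun j => by
    rw [innerSL_apply_apply]
    exact S.orthogonal _ _ (by push_cast; omega) _ _
  simp_rw [h2] at h1
  have h3 := h1.unique hasSum_zero
  rwa [innerSL_apply_apply, inner_sub_right, sub_eq_zero] at h3

theorem inner_noise_eq_zero (S : ScoreSystem X ε φ ψ) {k l : ℤ} (hkl : l < k) (x y : H) :
    (inner ℝ (ε k x) (X l y) : ℝ) = 0 := by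
  rw [S.inner_noise_sub hkl.le, S.orthogonal _ _ hkl.ne']

theorem eq_zero_of_noise_eq_zero (S : ScoreSystem X ε φ ψ) {k : ℤ} {x : H} (h : ε k x = 0) :
    x = 0 := by
  refine S.injective x ?_
  rw [← norm_eq_zero, ← S.norm_noise k, h, norm_zero]

/-- The operator `x ↦ ⟨x, X_0^{[L]}⟩`. -/
def lagMap (X : ℤ → H →L[ℝ] G) (L : ℕ) : HPow H L →L[ℝ] G :=
  rowMap fun i : Fin L => X (-((i : ℕ) : ℤ))

theorem lagMap_apply (X : ℤ → H →L[ℝ] G) (L : ℕ) (x : HPow H L) :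
    lagMap X L x = ∑ i : Fin L, X (-((i : ℕ) : ℤ)) (x i) := rowMap_apply _ _

/-- Blocks vanish one after another: pairing with `ε_{-n}(x_n)` kills the older blocks by
orthogonality, the newer ones are zero by induction, and `‖ε_{-n}(x_n)‖²` remains. -/
theorem lagMap_injective (S : ScoreSystem X ε φ ψ) (L : ℕ) (x : HPow H L)
    (hx : lagMap X L x = 0) : x = 0 := by
  have key : ∀ n : ℕ, ∀ hn : n < L, x ⟨n, hn⟩ = 0 := by
    intro n
    induction n using Nat.strong_induction_on with
    | _ n ih =>
      intro hn
      refine S.eq_zero_of_noise_eq_zero (k := -(n : ℤ)) ?_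
      have h1 : (inner ℝ (ε (-(n : ℤ)) (x ⟨n, hn⟩)) (lagMap X L x) : ℝ) = 0 := by
        rw [hx, inner_zero_right]
      rw [lagMap_apply, inner_sum, Finset.sum_eq_single ⟨n, hn⟩, S.inner_noise_sub le_rfl] at h1
      · exact inner_self_eq_zero.1 h1
      · intro i _ hi
        have hin : (i : ℕ) ≠ n := fun h => hi (Fin.ext h)
        rcases lt_or_gt_of_ne hin with h | h
        · rw [ih i h i.2, map_zero, inner_zero_right]
        · exact S.inner_noise_eq_zero (by omega) _ _
      · simp
  ext i
  exact key i i.2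

/-- Orthogonality across time gives Pythagoras instead of the triangle inequality, so the bound does
not grow with `L`. -/
theorem norm_sum_noise_le (S : ScoreSystem X ε φ ψ) {L : ℕ} (c : ℤ) (y : HPow H L) :
    ‖∑ i : Fin L, ε (c - (i : ℕ)) (y i)‖ ≤ ‖ε 0‖ * ‖y‖ := by
  refine le_of_sq_le_sq ?_ (by positivity)
  rw [← real_inner_self_eq_norm_sq, sum_inner, mul_pow, PiLp.norm_sq_eq_of_L2, Finset.mul_sum]
  refine Finset.sum_le_sum fun i _ => ?_
  rw [inner_sum, Finset.sum_eq_single i]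
  · rw [real_inner_self_eq_norm_sq, S.norm_noise, ← mul_pow]
    gcongr
    exact (ε 0).le_opNorm _
  · intro j _ hj
    refine S.orthogonal _ _ ?_ _ _
    have : (i : ℕ) ≠ j := fun h => hj (Fin.ext h.symm)
    omega
  · simp

/-- The spectrum of the covariance operator of `X^{[L]}` is bounded uniformly in `L`. -/
theorem norm_lagMap_le (S : ScoreSystem X ε φ ψ) (L : ℕ) :
    ‖lagMap X L‖ ≤ ‖ε 0‖ * (1 + ∑' j : ℕ, ‖φ (j + 1)‖) := by
  have hnn : 0 ≤ ∑' j : ℕ, ‖φ (j + 1)‖ := tsum_nonneg fun _ => norm_nonneg _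
  refine ContinuousLinearMap.opNorm_le_bound _ (by positivity) fun x => ?_
  -- The series is grouped by lag `j`, not by block `i`: each lag gives one time-shifted noise sum,
  -- bounded by `‖φ_{j+1}‖ ‖ε_0‖ ‖x‖`.
  have h1 : HasSum (fun j : ℕ => ∑ i : Fin L, ε (-((i : ℕ) : ℤ) - (j + 1 : ℕ))
      (ContinuousLinearMap.adjoint (φ (j + 1)) (x i)))
      (∑ i : Fin L, (X (-((i : ℕ) : ℤ)) (x i) - ε (-((i : ℕ) : ℤ)) (x i))) :=
    hasSum_sum fun i _ => S.causal _ _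
  rw [Finset.sum_sub_distrib, ← lagMap_apply] at h1
  have h2 : ∀ j : ℕ, ‖∑ i : Fin L, ε (-((i : ℕ) : ℤ) - (j + 1 : ℕ))
      (ContinuousLinearMap.adjoint (φ (j + 1)) (x i))‖ ≤
        ‖φ (j + 1)‖ * (‖ε 0‖ * ‖x‖) := fun j => by
    have e1 := S.norm_sum_noise_le (-((j + 1 : ℕ) : ℤ))
      (WithLp.toLp 2 fun i => ContinuousLinearMap.adjoint (φ (j + 1)) (x i) : HPow H L)
    have e2 : ‖(WithLp.toLp 2 fun i => ContinuousLinearMap.adjoint (φ (j + 1)) (x i) :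
        HPow H L)‖ ≤ ‖φ (j + 1)‖ * ‖x‖ := by
      refine le_of_sq_le_sq ?_ (by positivity)
      rw [PiLp.norm_sq_eq_of_L2, mul_pow, PiLp.norm_sq_eq_of_L2, Finset.mul_sum]
      refine Finset.sum_le_sum fun i _ => ?_
      rw [← mul_pow, ← LinearIsometryEquiv.norm_map ContinuousLinearMap.adjoint (φ (j + 1))]
      gcongr
      exact ContinuousLinearMap.le_opNorm _ _
    have e3 : ∀ i : Fin L, -((i : ℕ) : ℤ) - (j + 1 : ℕ) = -((j + 1 : ℕ) : ℤ) - (i : ℕ) :=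
      fun i => by ring
    simp_rw [e3]
    refine e1.trans ((mul_le_mul_of_nonneg_left e2 (norm_nonneg _)).trans_eq ?_)
    ring
  have h3 := h1.norm_le_of_bounded (S.summable_causal.mul_right _).hasSum h2
  rw [tsum_mul_right] at h3
  have h4 := S.norm_sum_noise_le 0 x
  simp_rw [zero_sub] at h4
  have h5 := norm_add_le (lagMap X L x - ∑ i : Fin L, ε (-((i : ℕ) : ℤ)) (x i))
    (∑ i : Fin L, ε (-((i : ℕ) : ℤ)) (x i))
  rw [sub_add_cancel] at h5
  linarith

theorem hsENorm_process (S : ScoreSystem X ε φ ψ) (k : ℤ) : hsENorm (X k) = hsENorm (X 0) := by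
  have h : ∀ x, ‖X k x‖ₑ = ‖X 0 x‖ₑ := fun x => by
    rw [← ofReal_norm, ← ofReal_norm, S.norm_process]
  simp_rw [hsENorm, h]

/-- At time 1 the lags `1, …, L` involve exactly `X_0, …, X_{1-L}`, the blocks of `X_0^{[L]}`; what
is left is the series from lag `L + 1` on. -/
theorem norm_inverse_tail_le (S : ScoreSystem X ε φ ψ) (L : ℕ) :
    ‖X 1 - ε 1 - lagMap X L ∘L
      ContinuousLinearMap.adjoint (rowOp fun i : Fin L => ψ (i + 1))‖ ≤
      ‖X 0‖ * ∑' l : ℕ, ‖ψ (L + 1 + l)‖ := by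
  have hsum : Summable fun l : ℕ => ‖ψ (L + 1 + l)‖ := by
    have := (summable_nat_add_iff L).2 S.summable_inverse
    refine this.congr fun l => ?_
    rw [show l + L + 1 = L + 1 + l by ring]
  have hnn : 0 ≤ ∑' l : ℕ, ‖ψ (L + 1 + l)‖ := tsum_nonneg fun _ => norm_nonneg _
  refine ContinuousLinearMap.opNorm_le_bound _ (by positivity) fun x => ?_
  have h1 := (hasSum_nat_add_iff' L).2 (S.inverse 1 x)
  have h2 : (X 1 - ε 1 - lagMap X L ∘L
      ContinuousLinearMap.adjoint (rowOp fun i : Fin L => ψ (i + 1))) x =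
      X 1 x - ε 1 x - ∑ j ∈ Finset.range L, X (1 - (j + 1 : ℕ))
        (ContinuousLinearMap.adjoint (ψ (j + 1)) x) := by
    rw [sub_apply, sub_apply, ContinuousLinearMap.comp_apply, lagMap_apply, rowOp_eq_rowMap,
      adjoint_rowMap_apply, Finset.sum_range]
    congr 1
    refine Finset.sum_congr rfl fun i _ => ?_
    rw [show (1 : ℤ) - ((i : ℕ) + 1 : ℕ) = -((i : ℕ) : ℤ) by push_cast; ring]
  rw [h2]
  have h3 : ∀ l : ℕ, ‖X (1 - ((l + L) + 1 : ℕ))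
      (ContinuousLinearMap.adjoint (ψ ((l + L) + 1)) x)‖ ≤
      ‖ψ (L + 1 + l)‖ * (‖X 0‖ * ‖x‖) := fun l => by
    rw [S.norm_process, show l + L + 1 = L + 1 + l by ring]
    refine ((X 0).le_opNorm _).trans ?_
    have := (ContinuousLinearMap.adjoint (ψ (L + 1 + l))).le_opNorm x
    rw [LinearIsometryEquiv.norm_map] at this
    nlinarith [norm_nonneg (X 0)]
  have h4 := h1.norm_le_of_bounded (hsum.mul_right _).hasSum h3
  rw [tsum_mul_right] at h4
  linarith

/-- The bias `𝒟 - Ψ_L 𝒞` that stems from the truncation of the inverted representation. -/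
theorem hsENorm_bias_le (S : ScoreSystem X ε φ ψ) (L : ℕ) {σ : ℝ}
    (hσ : hsENorm (X 0) ≤ ENNReal.ofReal σ) :
    hsENorm (ContinuousLinearMap.adjoint (X 1) ∘L lagMap X L -
      (rowOp fun i : Fin L => ψ (i + 1)) ∘L
        (ContinuousLinearMap.adjoint (lagMap X L) ∘L lagMap X L)) ≤
      ENNReal.ofReal ((‖X 0‖ * ∑' l : ℕ, ‖ψ (L + 1 + l)‖) * (√L * σ)) := by
  set R := rowOp fun i : Fin L => ψ (i + 1)
  set W := X 1 - ε 1 - lagMap X L ∘L ContinuousLinearMap.adjoint R with hW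
  -- The innovation `ε_1` is uncorrelated with every block of `X_0^{[L]}`, so only the truncated
  -- tail enters the bias.
  have h1 : ContinuousLinearMap.adjoint (ε 1) ∘L lagMap X L = 0 := by
    ext x
    refine ext_inner_left ℝ fun y => ?_
    rw [ContinuousLinearMap.comp_apply, ContinuousLinearMap.adjoint_inner_right, lagMap_apply,
      inner_sum, zero_apply, inner_zero_right]
    exact Finset.sum_eq_zero fun i _ => S.inner_noise_eq_zero (by omega) _ _
  have h2 : ContinuousLinearMap.adjoint (X 1) ∘L lagMap X L -
      R ∘L (ContinuousLinearMap.adjoint (lagMap X L) ∘L lagMap X L) =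
        ContinuousLinearMap.adjoint W ∘L lagMap X L := by
    rw [hW, map_sub, map_sub, ContinuousLinearMap.adjoint_comp,
      ContinuousLinearMap.adjoint_adjoint, ContinuousLinearMap.sub_comp,
      ContinuousLinearMap.sub_comp, h1, sub_zero, ContinuousLinearMap.comp_assoc]
  rw [h2]
  refine hsENorm_comp_le_ofReal ?_ ?_
  · rw [LinearIsometryEquiv.norm_map]
    exact S.norm_inverse_tail_le L
  · refine ennreal_le_of_sq_le ?_
    rw [lagMap, hsENorm_rowMap_sq]
    simp_rw [S.hsENorm_process]
    rw [Finset.sum_const, Finset.card_univ, Fintype.card_fin, nsmul_eq_mul,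
      ENNReal.ofReal_mul (by positivity), mul_pow, ← ENNReal.ofReal_pow (by positivity),
      Real.sq_sqrt (by positivity), ENNReal.ofReal_natCast]
    gcongr

/-- Uniqueness of expansions in `X`. Pairing with `ε_{k-m}` removes all terms older than `m`, and
those before `m` vanish by strong induction. -/
theorem eq_zero_of_hasSum (S : ScoreSystem X ε φ ψ) {k : ℤ} {A : ℕ → H →L[ℝ] H}
    (h : ∀ x, HasSum (fun m : ℕ => X (k - m) (ContinuousLinearMap.adjoint (A m) x)) 0) (m : ℕ) :
    A m = 0 := by
  induction m using Nat.strong_induction_on with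
  | _ m ih =>
    have key : ∀ x, ContinuousLinearMap.adjoint (A m) x = 0 := fun x => by
      refine S.eq_zero_of_noise_eq_zero (k := k - m) ?_
      set u := ContinuousLinearMap.adjoint (A m) x with hu
      have h1 := (h x).mapL (innerSL ℝ (ε (k - m) u))
      rw [map_zero] at h1
      have h2 := h1.unique (hasSum_single m fun n hn => ?_)
      · rw [innerSL_apply_apply, ← hu, S.inner_noise_sub le_rfl] at h2
        exact inner_self_eq_zero.1 h2.symm
      · rw [innerSL_apply_apply]
        rcases lt_or_gt_of_ne hn with hl | hl
        · rw [ih n hl]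
          simp
        · exact S.inner_noise_eq_zero (by omega) _ _
    have h3 : ContinuousLinearMap.adjoint (A m) = 0 := by
      ext x
      exact key x
    exact (LinearIsometryEquiv.map_eq_zero_iff _).1 h3

theorem hasSum_noise (S : ScoreSystem X ε φ ψ) (k : ℤ) (x : H) :
    HasSum (fun l : ℕ => X (k - l) (ContinuousLinearMap.adjoint
      (if l = 0 then ContinuousLinearMap.id ℝ H else -ψ l) x)) (ε k x) := by
  rw [← hasSum_nat_add_iff' 1]
  convert! (S.inverse k x).neg using 1
  · ext j
    simp
  · simp [ContinuousLinearMap.adjoint_id]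

/-- The recursion for the coefficients of the inverted representation. -/
theorem inverse_recursion (S : ScoreSystem X ε φ ψ) {p q : ℕ} {α β : ℕ → H →L[ℝ] H}
    (h : ∀ x, X 0 x = ε 0 x +
      ∑ i ∈ Finset.Icc 1 p, X (0 - i) (ContinuousLinearMap.adjoint (α i) x) +
      ∑ j ∈ Finset.Icc 1 q, ε (0 - j) (ContinuousLinearMap.adjoint (β j) x)) {m : ℕ}
    (hm : 1 ≤ m) :
    ψ m = (if m ≤ p then α m else 0) + (if m ≤ q then β m else 0) -
      ∑ j ∈ (Finset.Icc 1 q).filter (· < m), β j ∘L ψ (m - j) := by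
  -- With leading coefficient the identity, the defining equation reads `∑ b_j ε_{-j} = ∑ a_i
  -- X_{-i}`, and `c` expresses each `ε` through `X`.
  set a : ℕ → H →L[ℝ] H := fun i => if i = 0 then ContinuousLinearMap.id ℝ H else -α i with ha
  set b : ℕ → H →L[ℝ] H := fun j => if j = 0 then ContinuousLinearMap.id ℝ H else β j with hb
  set c : ℕ → H →L[ℝ] H := fun l => if l = 0 then ContinuousLinearMap.id ℝ H else -ψ l with hc
  have h1 : ∀ (j : ℕ) (y : H), HasSum (fun n : ℕ => if j ≤ n then
      X (0 - n) (ContinuousLinearMap.adjoint (c (n - j)) y) else 0) (ε (0 - j) y) := by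
    intro j y
    rw [← hasSum_nat_add_iff' j, Finset.sum_eq_zero fun i hi => if_neg
      (by have := Finset.mem_range.1 hi; omega), sub_zero]
    refine (S.hasSum_noise (0 - j) y).congr_fun fun l => ?_
    rw [if_pos (Nat.le_add_left j l), Nat.add_sub_cancel,
      show (0 : ℤ) - (l + j : ℕ) = 0 - j - l by push_cast; ring]
  have h2 : ∀ x, HasSum (fun n : ℕ => X (0 - n) (ContinuousLinearMap.adjoint
      (if n ≤ p then a n else 0) x))
      (∑ i ∈ Finset.range (p + 1), X (0 - i) (ContinuousLinearMap.adjoint (a i) x)) := by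
    intro x
    have e1 : ∑ i ∈ Finset.range (p + 1), X (0 - i) (ContinuousLinearMap.adjoint (a i) x) =
        ∑ n ∈ Finset.range (p + 1), X (0 - n) (ContinuousLinearMap.adjoint
          (if n ≤ p then a n else 0) x) :=
      Finset.sum_congr rfl fun i hi => by
        rw [if_pos (Nat.lt_succ_iff.1 (Finset.mem_range.1 hi))]
    rw [e1]
    refine hasSum_sum_of_ne_finset_zero fun n hn => ?_
    rw [if_neg (by rw [Finset.mem_range] at hn; omega)]
    simp
  -- Inserting the inverted representation of each `ε_{-j}` leaves a single series in `X` with sum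
  -- zero, so each coefficient vanishes; the `m`-th one is the claim.
  have hA : ∀ x, HasSum (fun n : ℕ => X (0 - n) (ContinuousLinearMap.adjoint
      (∑ j ∈ Finset.range (q + 1), (if j ≤ n then b j ∘L c (n - j) else 0) -
        if n ≤ p then a n else 0) x)) 0 := by
    intro x
    have e1 := (hasSum_sum fun j (_ : j ∈ Finset.range (q + 1)) =>
      h1 j (ContinuousLinearMap.adjoint (b j) x)).sub (h2 x)
    have e2 : ∑ j ∈ Finset.range (q + 1), ε (0 - j) (ContinuousLinearMap.adjoint (b j) x) -
        ∑ i ∈ Finset.range (p + 1), X (0 - i) (ContinuousLinearMap.adjoint (a i) x) = 0 := by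
      have e3 : ∑ i ∈ Finset.Icc 1 p, X (0 - i) (ContinuousLinearMap.adjoint (a i) x) =
          -∑ i ∈ Finset.Icc 1 p, X (0 - i) (ContinuousLinearMap.adjoint (α i) x) := by
        rw [← Finset.sum_neg_distrib]
        refine Finset.sum_congr rfl fun i hi => ?_
        have := (Finset.mem_Icc.1 hi).1
        rw [ha]
        simp [show i ≠ 0 by omega]
      have e4 : ∑ j ∈ Finset.Icc 1 q, ε (0 - j) (ContinuousLinearMap.adjoint (b j) x) =
          ∑ j ∈ Finset.Icc 1 q, ε (0 - j) (ContinuousLinearMap.adjoint (β j) x) := by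
        refine Finset.sum_congr rfl fun i hi => ?_
        have := (Finset.mem_Icc.1 hi).1
        rw [hb]
        simp [show i ≠ 0 by omega]
      rw [sum_range_succ_eq_add_sum_Icc, sum_range_succ_eq_add_sum_Icc, e3, e4]
      have e5 := h x
      simp only [ha, hb, if_true, ContinuousLinearMap.adjoint_id, ContinuousLinearMap.id_apply,
        Nat.cast_zero, sub_zero]
      rw [e5]
      abel
    rw [e2] at e1
    refine e1.congr_fun fun n => ?_
    rw [map_sub, sub_apply, map_sub, map_sum, sum_apply, map_sum]
    congr 1
    refine Finset.sum_congr rfl fun j _ => ?_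
    split_ifs
    · rw [ContinuousLinearMap.adjoint_comp, ContinuousLinearMap.comp_apply]
    · simp
  have hAm := S.eq_zero_of_hasSum hA m
  have hm0 : m ≠ 0 := by omega
  have hterm : ∀ j ∈ Finset.Icc 1 q, (if j ≤ m then b j ∘L c (m - j) else 0) =
      (if m = j then β j else 0) - if j < m then β j ∘L ψ (m - j) else 0 := by
    intro j hj
    have hj0 : j ≠ 0 := by
      have := (Finset.mem_Icc.1 hj).1
      omega
    rcases lt_trichotomy j m with hlt | rfl | hlt
    · rw [if_pos hlt.le, if_neg hlt.ne', if_pos hlt, hb, hc]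
      simp [hj0, show m - j ≠ 0 by omega]
    · rw [if_pos le_rfl, if_pos rfl, if_neg (lt_irrefl _), hb, hc]
      simp [hj0]
    · rw [if_neg (by omega), if_neg (by omega), if_neg (by omega), sub_zero]
  have hzero : (if 0 ≤ m then b 0 ∘L c (m - 0) else 0) = -ψ m := by
    simp [hb, hc, hm0]
  rw [sum_range_succ_eq_add_sum_Icc, Finset.sum_congr rfl hterm, hzero,
    Finset.sum_sub_distrib, Finset.sum_ite_eq, ← Finset.sum_filter] at hAm
  have ham : (if m ≤ p then a m else 0) = -(if m ≤ p then α m else 0) := by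
    split_ifs <;> simp [ha, hm0]
  have hbm : (if m ∈ Finset.Icc 1 q then β m else 0) = if m ≤ q then β m else 0 := by
    simp [hm]
  rw [ham, hbm] at hAm
  refine (sub_eq_zero.1 (Eq.trans ?_ hAm)).symm
  abel

theorem eq_zero_of_process_eq_zero (S : ScoreSystem X ε φ ψ) {k : ℤ} {x : H} (h : X k x = 0) :
    x = 0 := by
  refine S.eq_zero_of_noise_eq_zero (k := k) ?_
  rw [← inner_self_eq_zero (𝕜 := ℝ), ← S.inner_noise_sub le_rfl, h, inner_zero_right]

end ScoreSystem

theorem adjoint_comp_self_injective {E G : Type*} [NormedAddCommGroup E] [InnerProductSpace ℝ E]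
    [CompleteSpace E] [NormedAddCommGroup G] [InnerProductSpace ℝ G] [CompleteSpace G]
    {A : E →L[ℝ] G} (h : ∀ x, A x = 0 → x = 0) :
    Function.Injective (ContinuousLinearMap.adjoint A ∘L A) := by
  rw [injective_iff_map_eq_zero]
  intro x hx
  refine h x ?_
  rw [← inner_self_eq_zero (𝕜 := ℝ), ← ContinuousLinearMap.adjoint_inner_left,
    ← ContinuousLinearMap.comp_apply, hx, inner_zero_left]

/-! ### Transfer from the process to its score operators. -/

section Processes

variable {Ω : Type*} [MeasurableSpace Ω] {μ : Measure Ω}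
  {H : Type*} [NormedAddCommGroup H] [InnerProductSpace ℝ H] [CompleteSpace H]

/-- Adjoints appear because `⟨x, A Z⟩ = ⟨A* x, Z⟩`. The uniform bound `c` makes the series of scores
absolutely convergent in `L²`, and the almost sure identity determines its sum. -/
theorem hasSum_scoreMap {Z : ℕ → Ω → H} {U V : Ω → H} (hZ : ∀ j, MemLp (Z j) 2 μ)
    (hU : MemLp U 2 μ) (hV : MemLp V 2 μ) {A : ℕ → H →L[ℝ] H} (hA : Summable fun j => ‖A j‖)
    {c : ℝ} (hc0 : 0 ≤ c) (hc : ∀ j x, ‖scoreMap (hZ j) x‖ ≤ c * ‖x‖)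
    (h : ∀ᵐ ω ∂μ, HasSum (fun j => A j (Z j ω)) (U ω - V ω)) (x : H) :
    HasSum (fun j => scoreMap (hZ j) (ContinuousLinearMap.adjoint (A j) x))
      (scoreMap hU x - scoreMap hV x) := by
  refine hasSum_Lp_of_ae (Summable.of_nonneg_of_le (fun _ => norm_nonneg _) (fun j => ?_)
    (hA.mul_right (c * ‖x‖))) ?_
  · refine (hc j _).trans ?_
    have := (ContinuousLinearMap.adjoint (A j)).le_opNorm x
    rw [LinearIsometryEquiv.norm_map] at this
    nlinarith
  · have h1 : ∀ᵐ ω ∂μ, ∀ j, scoreMap (hZ j) (ContinuousLinearMap.adjoint (A j) x) ω =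
        inner ℝ (ContinuousLinearMap.adjoint (A j) x) (Z j ω) :=
      ae_all_iff.2 fun j => scoreMap_coeFn _ _
    filter_upwards [h, h1, scoreMap_coeFn hU x, scoreMap_coeFn hV x,
      Lp.coeFn_sub (scoreMap hU x) (scoreMap hV x)] with ω e1 e2 e3 e4 e5
    rw [e5, Pi.sub_apply, e3, e4, ← inner_sub_right]
    have e6 := e1.mapL (innerSL ℝ x)
    rw [innerSL_apply_apply] at e6
    refine e6.congr_fun fun j => ?_
    rw [e2, ContinuousLinearMap.adjoint_inner_left, innerSL_apply_apply]

theorem norm_scoreMap_eq_of_isStationary [MeasurableSpace H] [BorelSpace H]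
    [SecondCountableTopology H] {X : ℤ → Ω → H} (h : IsStationary μ X)
    (hX : ∀ k, MemLp (X k) 2 μ) (k : ℤ) (x : H) :
    ‖scoreMap (hX k) x‖ = ‖scoreMap (hX 0) x‖ := by
  have hmap := h.2 1 (fun _ => 0) k
  have hae : ∀ l : ℤ, AEMeasurable (fun ω (_ : Fin 1) => X l ω) μ := fun l =>
    aemeasurable_pi_lambda _ fun _ => h.1 l
  have hg : Measurable fun y : Fin 1 → H => (inner ℝ x (y 0) : ℝ) ^ 2 :=
    ((measurable_const.inner (measurable_pi_apply 0))).pow_const 2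
  have key : ∀ l : ℤ, ‖scoreMap (hX l) x‖ ^ 2 =
      ∫ y, (inner ℝ x (y 0) : ℝ) ^ 2 ∂(μ.map fun ω (_ : Fin 1) => X l ω) := fun l => by
    rw [norm_scoreMap_sq, integral_map (hae l) hg.aestronglyMeasurable]
  have h2 : ‖scoreMap (hX k) x‖ ^ 2 = ‖scoreMap (hX 0) x‖ ^ 2 := by
    rw [key, key, hmap, zero_add]
  exact (pow_left_inj₀ (norm_nonneg _) (norm_nonneg _) two_ne_zero).1 h2

theorem norm_scoreMap_eq_of_isWhiteNoise {ε : ℤ → Ω → H} (h : IsWhiteNoise μ ε)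
    (hε : ∀ k, MemLp (ε k) 2 μ) (k : ℤ) (x : H) :
    ‖scoreMap (hε k) x‖ = ‖scoreMap (hε 0) x‖ := by
  have h1 : ∀ l, ‖scoreMap (hε l) x‖ ^ 2 = inner ℝ (crossCov μ (ε l) (ε l) x) x := fun l => by
    rw [inner_crossCov (hε l) (hε l) (h.centered l).2 (h.centered l).2,
      real_inner_self_eq_norm_sq]
  have h2 : ‖scoreMap (hε k) x‖ ^ 2 = ‖scoreMap (hε 0) x‖ ^ 2 := by
    rw [h1, h1, h.weaklyStationary.cov k 0 0, zero_add]
  exact (pow_left_inj₀ (norm_nonneg _) (norm_nonneg _) two_ne_zero).1 h2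

theorem scoreSystem [MeasurableSpace H] [BorelSpace H] [SecondCountableTopology H]
    {X ε : ℤ → Ω → H} {φ ψ : ℕ → H →L[ℝ] H} (hnoise : IsWhiteNoise μ ε)
    (hlin : IsCausalLinear μ X ε φ) (hinv : IsInvertible μ X ε ψ)
    (hX2 : ∀ k, MemLp (X k) 2 μ) (hε2 : ∀ k, MemLp (ε k) 2 μ)
    (hinj : Function.Injective (covOp μ (ε 0)))
    (hψsum : Summable fun l : ℕ => ‖ψ (l + 1)‖) :
    ScoreSystem (fun k => scoreMap (hX2 k)) (fun k => scoreMap (hε2 k)) φ ψ where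
  orthogonal k l hkl x y := by
    rw [← inner_crossCov (hε2 k) (hε2 l) (hnoise.centered k).2 (hnoise.centered l).2,
      hnoise.uncorrelated k l hkl]
    simp
  norm_noise := norm_scoreMap_eq_of_isWhiteNoise hnoise hε2
  injective x hx := by
    refine hinj ?_
    rw [map_zero, covOp, crossCov_eq (hε2 0) (hε2 0) (hnoise.centered 0).2 (hnoise.centered 0).2,
      ContinuousLinearMap.comp_apply, hx, map_zero]
  norm_process := norm_scoreMap_eq_of_isStationary hinv.stationary hX2
  summable_causal := hlin.summable
  summable_inverse := hψsum
  causal k := hasSum_scoreMap (fun _ => hε2 _) (hX2 k) (hε2 k) hlin.summable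
    (norm_nonneg (scoreMap (hε2 0))) (fun j x => by
      rw [norm_scoreMap_eq_of_isWhiteNoise hnoise hε2]
      exact ContinuousLinearMap.le_opNorm _ _) (hlin.eqn k)
  inverse k := hasSum_scoreMap (fun _ => hX2 _) (hX2 k) (hε2 k) hψsum
    (norm_nonneg (scoreMap (hX2 0))) (fun j x => by
      rw [norm_scoreMap_eq_of_isStationary hinv.stationary hX2]
      exact ContinuousLinearMap.le_opNorm _ _) (hinv.eqn k)

theorem scoreMap_eqn {X ε : ℤ → Ω → H} {p q : ℕ} {α β : ℕ → H →L[ℝ] H}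
    (h : IsFARMA μ X ε p q α β) (hX2 : ∀ k, MemLp (X k) 2 μ) (hε2 : ∀ k, MemLp (ε k) 2 μ)
    (k : ℤ) (x : H) :
    scoreMap (hX2 k) x = scoreMap (hε2 k) x +
      ∑ i ∈ Finset.Icc 1 p, scoreMap (hX2 (k - i)) (ContinuousLinearMap.adjoint (α i) x) +
      ∑ j ∈ Finset.Icc 1 q, scoreMap (hε2 (k - j)) (ContinuousLinearMap.adjoint (β j) x) := by
  set f : ℕ → Lp ℝ 2 μ := fun i =>
    scoreMap (hX2 (k - i)) (ContinuousLinearMap.adjoint (α i) x) with hf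
  set g : ℕ → Lp ℝ 2 μ := fun j =>
    scoreMap (hε2 (k - j)) (ContinuousLinearMap.adjoint (β j) x) with hg
  have h1 : ∀ᵐ ω ∂μ, ∀ i, f i ω = inner ℝ (ContinuousLinearMap.adjoint (α i) x) (X (k - i) ω) :=
    ae_all_iff.2 fun i => scoreMap_coeFn _ _
  have h2 : ∀ᵐ ω ∂μ, ∀ j, g j ω = inner ℝ (ContinuousLinearMap.adjoint (β j) x) (ε (k - j) ω) :=
    ae_all_iff.2 fun j => scoreMap_coeFn _ _
  refine Lp.ext ?_
  filter_upwards [h.eqn k, h1, h2, scoreMap_coeFn (hX2 k) x, scoreMap_coeFn (hε2 k) x,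
    Lp.coeFn_add (scoreMap (hε2 k) x + ∑ i ∈ Finset.Icc 1 p, f i) (∑ j ∈ Finset.Icc 1 q, g j),
    Lp.coeFn_add (scoreMap (hε2 k) x) (∑ i ∈ Finset.Icc 1 p, f i),
    Lp.coeFn_fun_finsetSum (Finset.Icc 1 p) f, Lp.coeFn_fun_finsetSum (Finset.Icc 1 q) g]
    with ω e0 e1 e2 e3 e4 e5 e6 e7 e8
  rw [e5, Pi.add_apply, e6, Pi.add_apply, e7, e8, e3, e4, e0, inner_add_right, inner_add_right,
    inner_sum, inner_sum]
  simp_rw [e1, e2, ContinuousLinearMap.adjoint_inner_left]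

theorem lagVec_eq_sum (X : ℤ → Ω → H) (L : ℕ) (k : ℤ) (ω : Ω) :
    lagVec X L k ω = ∑ i : Fin L, embed i (X (k - (i : ℕ)) ω) := by
  ext j
  simp [lagVec, embed_apply]

theorem memLp_lagVec {X : ℤ → Ω → H} (hX2 : ∀ k, MemLp (X k) 2 μ) (L : ℕ) (k : ℤ) :
    MemLp (lagVec X L k) 2 μ := by
  have h : lagVec X L k = fun ω => ∑ i : Fin L, embed i (X (k - (i : ℕ)) ω) :=
    funext (lagVec_eq_sum X L k)
  rw [h]
  exact memLp_finsetSum _ fun i _ =>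
    ContinuousLinearMap.comp_memLp' (embed i : H →L[ℝ] HPow H L) (hX2 (k - (i : ℕ)))

theorem integral_lagVec {X : ℤ → Ω → H} (hX : IsCentered μ X) (L : ℕ) (k : ℤ) :
    ∫ ω, lagVec X L k ω ∂μ = 0 := by
  simp_rw [lagVec_eq_sum]
  rw [integral_finsetSum _ fun i _ => (embed i).integrable_comp (hX _).1]
  refine Finset.sum_eq_zero fun i _ => ?_
  rw [ContinuousLinearMap.integral_comp_comm _ (hX _).1, (hX _).2, map_zero]

theorem scoreMap_lagVec {X : ℤ → Ω → H} (hX2 : ∀ k, MemLp (X k) 2 μ) (L : ℕ) :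
    scoreMap (memLp_lagVec hX2 L 0) = ScoreSystem.lagMap (fun k => scoreMap (hX2 k)) L := by
  ext1 x
  rw [ScoreSystem.lagMap_apply]
  have h1 : ∀ᵐ ω ∂μ, ∀ i : Fin L, scoreMap (hX2 (-((i : ℕ) : ℤ))) (x i) ω =
      inner ℝ (x i) (X (-((i : ℕ) : ℤ)) ω) := ae_all_iff.2 fun i => scoreMap_coeFn _ _
  refine Lp.ext ?_
  filter_upwards [scoreMap_coeFn (memLp_lagVec hX2 L 0) x, h1, Lp.coeFn_fun_finsetSum Finset.univ
    fun i : Fin L => scoreMap (hX2 (-((i : ℕ) : ℤ))) (x i)] with ω e1 e2 e3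
  rw [e1, e3, PiLp.inner_apply]
  refine Finset.sum_congr rfl fun i _ => ?_
  rw [e2]
  simp [lagVec]

theorem covOp_lagVec {X : ℤ → Ω → H} (hX : IsCentered μ X) (hX2 : ∀ k, MemLp (X k) 2 μ) (L : ℕ) :
    covOp μ (lagVec X L 0) =
      ContinuousLinearMap.adjoint (ScoreSystem.lagMap (fun k => scoreMap (hX2 k)) L) ∘L
        ScoreSystem.lagMap (fun k => scoreMap (hX2 k)) L := by
  rw [covOp, crossCov_eq (memLp_lagVec hX2 L 0) (memLp_lagVec hX2 L 0) (integral_lagVec hX L 0)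
    (integral_lagVec hX L 0), scoreMap_lagVec]

theorem crossCov_lagVec {X : ℤ → Ω → H} (hX : IsCentered μ X) (hX2 : ∀ k, MemLp (X k) 2 μ)
    (L : ℕ) :
    crossCov μ (lagVec X L 0) (X 1) = ContinuousLinearMap.adjoint (scoreMap (hX2 1)) ∘L
      ScoreSystem.lagMap (fun k => scoreMap (hX2 k)) L := by
  rw [crossCov_eq (memLp_lagVec hX2 L 0) (hX2 1) (integral_lagVec hX L 0) (hX 1).2,
    scoreMap_lagVec]

end Processes

/-! ### Rates of the two stages and the passage to stochastic boundedness. -/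

section Rates

variable {H : Type*} [NormedAddCommGroup H] [InnerProductSpace ℝ H] [CompleteSpace H]

theorem gap_bounds {E : Type*} [NormedAddCommGroup E] [InnerProductSpace ℝ E] [CompleteSpace E]
    {T : E →L[ℝ] E} {v : ℕ → ℝ} {e : ℕ → E} (h : IsEigenSystem T v e)
    (hv : ∀ j, v j ≠ v (j + 1)) (m : ℕ) :
    0 < v m - v (m + 1) ∧ v m - v (m + 1) ≤ v m ∧ 0 < v m := by
  have h1 : v (m + 1) < v m := lt_of_le_of_ne (h.antitone m.le_succ) (hv m).symm
  have h2 := h.nonneg (m + 1)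
  exact ⟨by linarith, by linarith, by linarith⟩

theorem eventually_le_mul_of_isBigO {f g : ℕ → ℝ} (h : f =O[atTop] g) (hg : ∀ N, 0 ≤ g N) :
    ∃ c, 0 < c ∧ ∀ᶠ N in atTop, f N ≤ c * g N := by
  obtain ⟨c, hc, hb⟩ := h.exists_pos
  refine ⟨c, hc, hb.bound.mono fun N hN => (le_abs_self _).trans ?_⟩
  rwa [Real.norm_eq_abs, Real.norm_of_nonneg (hg N)] at hN

theorem eventually_le_of_isLittleO {f g : ℕ → ℝ} (h : f =o[atTop] g) (hg : ∀ N, 0 ≤ g N) :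
    ∀ᶠ N in atTop, f N ≤ g N := by
  filter_upwards [h.bound one_pos] with N hN
  rw [Real.norm_eq_abs, Real.norm_of_nonneg (hg N), one_mul] at hN
  exact (le_abs_self _).trans hN

theorem tendsto_const_mul_rpow_neg {k : ℕ → ℕ} (hk : Tendsto k atTop atTop) {s : ℝ} (hs : 0 < s)
    (a : ℝ) : Tendsto (fun N => a * (k N : ℝ) ^ (-s)) atTop (𝓝 0) := by
  have h1 := (tendsto_rpow_neg_atTop hs).comp (tendsto_natCast_atTop_atTop.comp hk)
  simpa using h1.const_mul a

theorem mul_le_mul_rpow_neg {k x c s : ℝ} (hk : 1 ≤ k)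
    (h : k ^ (1 + s) * x ≤ c) : k * x ≤ c * k ^ (-s) := by
  have hk0 : 0 < k := by linarith
  calc k * x = k ^ (1 + s) * x * k ^ (-s) := by
        rw [Real.rpow_add hk0, Real.rpow_neg hk0.le, Real.rpow_one]
        have : k ^ s ≠ 0 := by positivity
        field_simp
    _ ≤ _ := by gcongr

/-- Bookkeeping shared by both stages: `z` is the inverse of the last retained eigenvalue, `g` the
inverse gap, and `x`, `y`, `u` bound the amplified errors. -/
theorem regularized_error_le {a b t θ z g s x y u : ℝ} (ht : 0 ≤ t) (haz : a * z ≤ x)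
    (hag : a * g ≤ x) (hbz : b * z ≤ y) (hθz : θ * z ≤ u) :
    (b + t * a + θ * t) * (2 * z) + t * (4 * a * g) + s ≤
      2 * (y + t * x + t * u) + 4 * t * x + s := by
  have h1 := mul_le_mul_of_nonneg_left haz ht
  have h2 := mul_le_mul_of_nonneg_left hag ht
  have h3 := mul_le_mul_of_nonneg_left hθz ht
  linarith

/-- The rate of convergence of the regularized estimators of the truncated operators `Ψ_L`. -/
theorem first_stage_rate {E : ℕ → Type*} [∀ N, NormedAddCommGroup (E N)]
    [∀ N, InnerProductSpace ℝ (E N)] [∀ N, CompleteSpace (E N)]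
    {L K : ℕ → ℕ} {θ : ℕ → ℝ} (hL1 : ∀ N, 1 ≤ L N) (hK1 : ∀ N, 1 ≤ K N)
    (hK : Tendsto K atTop atTop) (hθ0 : ∀ N, 0 < θ N)
    {C : ∀ N, E N →L[ℝ] E N} {D T : ∀ N, E N →L[ℝ] H}
    {lam : ℕ → ℕ → ℝ} {c : ∀ N, ℕ → E N} (hc : ∀ N, IsEigenSystem (C N) (lam N) (c N))
    (hC : ∀ N, Function.Injective (C N)) (hsimple : ∀ N j, lam N j ≠ lam N (j + 1))
    {d : ℕ → H} (f : HilbertBasis ℕ ℝ H) (hd : ∀ j, f j = d j)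
    {B σ t : ℝ} (hB : ∀ N, ‖C N‖ ≤ B) (hσ : 0 ≤ σ) (ht0 : 0 ≤ t)
    {τ : ℕ → ℝ} (hτ : ∀ N, 0 ≤ τ N)
    (hbias : ∀ N, hsENorm (D N - T N ∘L C N) ≤ ENNReal.ofReal (σ * (τ N * √(L N))))
    (ht : ∀ N, hsENorm (T N) ≤ ENNReal.ofReal t) {s : ℝ} (hs : 0 < s)
    (hSob : limsup (fun N => sobolevSum (T N) (c N) d s (K N)) atTop ≠ ⊤)
    (hKL : (fun N => (K N : ℝ) ^ (1 + s) * (lam N (K N - 1))⁻¹ * gapSup (lam N) (K N) *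
      (L N : ℝ) ^ 2) =O[atTop] fun N => (N : ℝ) ^ (1 / 2 : ℝ))
    (htail : τ =o[atTop] fun N => (K N : ℝ) * gapSup (lam N) (K N) * (L N : ℝ) ^ (3 / 2 : ℝ) *
        (N : ℝ) ^ (-1 / 2 : ℝ))
    (hθrate : θ =o[atTop]
      fun N => (K N : ℝ) * gapSup (lam N) (K N) * (L N : ℝ) ^ 2 * (N : ℝ) ^ (-1 / 2 : ℝ))
    {C₁ C₂ : ℝ} (hC₁ : 0 ≤ C₁) (hC₂ : 0 ≤ C₂) :
    ∃ A, 0 ≤ A ∧ ∀ᶠ N in atTop, ∀ (C' : E N →L[ℝ] E N) (D' : E N →L[ℝ] H) (v' : ℕ → ℝ)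
      (e' : ℕ → E N), IsEigenSystem C' v' e' →
      hsENorm (C' - C N) ≤
        ENNReal.ofReal (C₁ * ((L N : ℝ) ^ (3 / 2 : ℝ) * (N : ℝ) ^ (-1 / 2 : ℝ))) →
      hsENorm (D' - D N) ≤ ENNReal.ofReal (C₂ * ((L N : ℝ) * (N : ℝ) ^ (-1 / 2 : ℝ))) →
      hsENorm (tychonoff D' C' (θ N) e' (K N) - T N) ≤
        ENNReal.ofReal (A * (K N : ℝ) ^ (-s)) := by
  have hgap : ∀ N, (lam N (K N - 1) - lam N (K N - 1 + 1))⁻¹ ≤ gapSup (lam N) (K N) :=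
    fun N => inv_sub_le_gapSup _ (by have := hK1 N; omega)
  have hΛ0 : ∀ N, 0 < gapSup (lam N) (K N) := fun N =>
    (inv_pos.2 (gap_bounds (hc N) (hsimple N) _).1).trans_le (hgap N)
  obtain ⟨c₁, hc₁, hKL'⟩ := eventually_le_mul_of_isBigO hKL fun N => by positivity
  have htail' := eventually_le_of_isLittleO htail fun N => by have := hΛ0 N; positivity
  have hθ' := eventually_le_of_isLittleO hθrate fun N => by have := hΛ0 N; positivity
  -- A finite level strictly above the limsup bounds the Sobolev tails eventually.
  obtain ⟨S, hS1, hS2⟩ := exists_between (lt_top_iff_ne_top.2 hSob)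
  have hSob' := eventually_lt_of_limsup_lt hS1
  set s₀ := √S.toReal with hs₀
  have hs₀S : ENNReal.ofReal (s₀ ^ 2) = S := by
    rw [Real.sq_sqrt ENNReal.toReal_nonneg, ENNReal.ofReal_toReal hS2.ne]
  have hB0 : 0 ≤ B := (norm_nonneg _).trans (hB 0)
  -- This ensures that eventually the covariance error is at most half the spectral gap, as the
  -- perturbation bound requires.
  have hsmall := (tendsto_const_mul_rpow_neg hK hs (C₁ * B * c₁)).eventually_le_const
    (by norm_num : (0 : ℝ) < 1 / 2)
  -- Neither this constant nor the threshold for `N` depends on the empirical operators, which are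
  -- quantified afterwards; the bound is therefore uniform in `ω`.
  refine ⟨(2 * (C₂ * B + σ + t * (C₁ * B) + t) + 4 * t * (C₁ * B)) * c₁ + s₀, by positivity, ?_⟩
  filter_upwards [hKL', htail', hθ', hSob', hsmall, eventually_ge_atTop 1]
    with N h1 h2 h3 h4 h5 hN C' D' v' e' hv' hC' hD'
  obtain ⟨hg0, hgle, hlam0⟩ := gap_bounds (hc N) (hsimple N) (K N - 1)
  have hK' : K N - 1 + 1 = K N := Nat.sub_add_cancel (hK1 N)
  have hlamB := ((hc N).le_opNorm (K N - 1)).trans (hB N)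
  have hgN := hgap N
  have hΛ := hΛ0 N
  have hSobN := hsENorm_sub_comp_projFirst_le ((hc N).hilbertBasis (hC N))
    ((hc N).hilbertBasis_apply (hC N)) f hd (T N) hs (hK1 N) (Real.sqrt_nonneg _)
    (h4.le.trans_eq hs₀S.symm)
  have hinj := hC N
  have htN := ht N
  have hbN := hbias N
  have hτN := hτ N
  set g := lam N (K N - 1) - lam N (K N - 1 + 1) with hg
  set l := lam N (K N - 1) with hl
  set Λ := gapSup (lam N) (K N)
  set k : ℝ := (K N : ℝ)
  set n : ℝ := (N : ℝ) ^ (-1 / 2 : ℝ)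
  set x : ℝ := (L N : ℝ)
  have hx1 : (1 : ℝ) ≤ x := Nat.one_le_cast.2 (hL1 N)
  have hk1 : (1 : ℝ) ≤ k := Nat.one_le_cast.2 (hK1 N)
  have hNpos : (0 : ℝ) < N := by exact_mod_cast hN
  have hn0 : 0 < n := by positivity
  have hnn : (N : ℝ) ^ (1 / 2 : ℝ) * n = 1 := by
    rw [← Real.rpow_add hNpos]
    norm_num
  set r := k ^ (-s)
  have hr0 : 0 ≤ r := by positivity
  -- The common yardstick: every amplified error is a multiple of `ρ`, and the growth condition
  -- gives `ρ ≤ c₁ K^{-s}`.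
  set ρ := k * Λ * x ^ 2 * n * l⁻¹ with hρ
  have hρ0 : 0 ≤ ρ := by positivity
  have hρr : ρ ≤ c₁ * r := by
    have e1 : k ^ (1 + s) * (l⁻¹ * Λ * x ^ 2 * n) ≤ c₁ := by
      calc _ = k ^ (1 + s) * l⁻¹ * Λ * x ^ 2 * n := by ring
        _ ≤ c₁ * (N : ℝ) ^ (1 / 2 : ℝ) * n := by gcongr
        _ = c₁ := by rw [mul_assoc, hnn, mul_one]
    calc ρ = k * (l⁻¹ * Λ * x ^ 2 * n) := by rw [hρ]; ring
      _ ≤ _ := mul_le_mul_rpow_neg hk1 e1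
  have hlinv : l⁻¹ ≤ g⁻¹ := inv_anti₀ hg0 hgle
  -- The factors missing from `ρ` are supplied by `K ≥ 1` and `B / λ_K ≥ 1`.
  have hunit : ∀ w : ℝ, 0 ≤ w → w ≤ x ^ 2 → w * n * g⁻¹ ≤ B * ρ := fun w hw0 hw => by
    have e1 : 1 ≤ B * l⁻¹ := by
      rw [← div_eq_mul_inv, one_le_div hlam0]
      exact hlamB
    calc w * n * g⁻¹ ≤ x ^ 2 * n * Λ := by gcongr
      _ = 1 * (x ^ 2 * n * Λ) * 1 := by ring
      _ ≤ k * (x ^ 2 * n * Λ) * (B * l⁻¹) := by gcongr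
      _ = B * ρ := by rw [hρ]; ring
  have hx32 : x ^ (3 / 2 : ℝ) ≤ x ^ 2 := by
    rw [← Real.rpow_two]
    exact Real.rpow_le_rpow_of_exponent_le hx1 (by norm_num)
  have hxs : x ^ (3 / 2 : ℝ) * √x = x ^ 2 := by
    rw [Real.sqrt_eq_rpow, ← Real.rpow_add (by linarith), ← Real.rpow_two]
    norm_num
  set a := C₁ * (x ^ (3 / 2 : ℝ) * n) with ha
  set b := C₂ * (x * n) + σ * (τ N * √x) with hb
  have ha0 : 0 ≤ a := by positivity
  have hb0 : 0 ≤ b := by positivity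
  have hag : a * g⁻¹ ≤ C₁ * B * ρ := by
    calc a * g⁻¹ = C₁ * (x ^ (3 / 2 : ℝ) * n * g⁻¹) := by rw [ha]; ring
      _ ≤ C₁ * (B * ρ) := mul_le_mul_of_nonneg_left (hunit _ (by positivity) hx32) hC₁
      _ = _ := by ring
  have hal : a * l⁻¹ ≤ C₁ * B * ρ := le_trans (by gcongr) hag
  have hbl : b * l⁻¹ ≤ (C₂ * B + σ) * ρ := by
    have e1 : x * n * l⁻¹ ≤ B * ρ :=
      le_trans (by gcongr) (hunit x (by positivity) (by nlinarith))
    -- The `√L` of the bias complements the `L^{3/2}` in the tail condition to the `L²` of `ρ`.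
    have e2 : τ N * √x * l⁻¹ ≤ ρ := by
      calc τ N * √x * l⁻¹ ≤ k * Λ * x ^ (3 / 2 : ℝ) * n * √x * l⁻¹ := by gcongr
        _ = k * Λ * (x ^ (3 / 2 : ℝ) * √x) * n * l⁻¹ := by ring
        _ = ρ := by rw [hxs]
    calc b * l⁻¹ = C₂ * (x * n * l⁻¹) + σ * (τ N * √x * l⁻¹) := by rw [hb]; ring
      _ ≤ C₂ * (B * ρ) + σ * ρ := by gcongr
      _ = _ := by ring
  have hθl : θ N * l⁻¹ ≤ ρ := by
    rw [hρ]
    gcongr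
  have hahalf : a ≤ g / 2 := by
    have e1 : a * g⁻¹ ≤ 1 / 2 := by
      refine hag.trans (le_trans ?_ h5)
      calc C₁ * B * ρ ≤ C₁ * B * (c₁ * r) := by gcongr
        _ = _ := by ring
    rw [← div_eq_mul_inv, div_le_iff₀ hg0] at e1
    linarith
  have hDT : hsENorm (D' - T N ∘L C N) ≤ ENNReal.ofReal b := by
    rw [← sub_add_sub_cancel D' (D N)]
    exact hsENorm_add_le_ofReal (by positivity) (by positivity) hD' hbN
  have key := hsENorm_tychonoff_sub_le (hc N) hv' hinj (T N) D' (m := K N - 1) (hθ0 N) ha0 hb0 ht0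
    (by positivity : 0 ≤ s₀ * r) hC' hDT htN (by rwa [hK']) (by linarith) hahalf
  rw [hK'] at key hg
  rw [← hl, ← hg] at key
  refine key.trans (ENNReal.ofReal_le_ofReal ?_)
  refine (regularized_error_le ht0 hal hag hbl hθl).trans ?_
  calc 2 * ((C₂ * B + σ) * ρ + t * (C₁ * B * ρ) + t * ρ) + 4 * t * (C₁ * B * ρ) + s₀ * r
      = (2 * (C₂ * B + σ + t * (C₁ * B) + t) + 4 * t * (C₁ * B)) * ρ + s₀ * r := by ring
    _ ≤ (2 * (C₂ * B + σ + t * (C₁ * B) + t) + 4 * t * (C₁ * B)) * (c₁ * r) + s₀ * r := by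
        gcongr
    _ = _ := by ring

set_option maxHeartbeats 800000 in
/-- The rate of convergence of the estimators of the moving average operators. -/
theorem second_stage_rate {p q : ℕ} (hp : 1 ≤ p) {K M : ℕ → ℕ} {γ : ℕ → ℝ}
    (hK1 : ∀ N, 1 ≤ K N) (hM1 : ∀ N, 1 ≤ M N) (hK : Tendsto K atTop atTop)
    (hM : Tendsto M atTop atTop) (hγ0 : ∀ N, 0 < γ N) {ψ : ℕ → H →L[ℝ] H}
    {B : HPow H q →L[ℝ] H} (hB : B ∘L blockOp ψ p q = -psiRow ψ p q q)
    (hdense : DenseRange (blockOp ψ p q)) {ζ : ℕ → ℝ} {h : ℕ → HPow H q}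
    (hh : IsEigenSystem (blockGram ψ p q) ζ h) (hζ : ∀ j, ζ j ≠ ζ (j + 1))
    {d : ℕ → H} (f : HilbertBasis ℕ ℝ H) (hd : ∀ j, f j = d j)
    {t : ℝ} (ht0 : 0 ≤ t) (ht : hsENorm B ≤ ENNReal.ofReal t) {s s' : ℝ} (hs : 0 < s)
    (hs' : 0 < s') (hSob : sobolevSum B h d s' 0 ≠ ⊤)
    (hMK : (fun N => (M N : ℝ) ^ (1 + s') * (ζ (M N - 1))⁻¹ * gapSup ζ (M N)) =O[atTop]
      fun N => (K N : ℝ) ^ s)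
    (hγrate : γ =o[atTop] fun N => ζ (M N - 1) * (M N : ℝ) ^ (-s')) {A : ℝ} (hA : 0 ≤ A) :
    ∃ A', 0 ≤ A' ∧ ∀ᶠ N in atTop, A * (K N : ℝ) ^ (-s) ≤ A' * (M N : ℝ) ^ (-s') ∧
      A * (K N : ℝ) ^ (-s) ≤ 1 ∧
      ∀ (ψ' : ℕ → H →L[ℝ] H) (ζ' : ℕ → ℝ) (h' : ℕ → HPow H q),
      IsEigenSystem (blockGram ψ' p q) ζ' h' →
      (∀ j, 1 ≤ j → j ≤ p + 2 * q →
        hsENorm (ψ' j - ψ j) ≤ ENNReal.ofReal (A * (K N : ℝ) ^ (-s))) →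
      hsENorm (bHat ψ' p q (M N) (γ N) h' - B) ≤ ENNReal.ofReal (A' * (M N : ℝ) ^ (-s')) := by
  have hgap : ∀ N, (ζ (M N - 1) - ζ (M N - 1 + 1))⁻¹ ≤ gapSup ζ (M N) :=
    fun N => inv_sub_le_gapSup _ (by have := hM1 N; omega)
  have hZ0 : ∀ N, 0 < gapSup ζ (M N) := fun N =>
    (inv_pos.2 (gap_bounds hh hζ _).1).trans_le (hgap N)
  obtain ⟨c, hc, hMK'⟩ := eventually_le_mul_of_isBigO hMK fun N => by positivity
  have hγ' := eventually_le_of_isLittleO hγrate fun N => by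
    have := (gap_bounds hh hζ (M N - 1)).2.2
    positivity
  have hinj := blockGram_injective hdense
  set s₀ := √(sobolevSum B h d s' 0).toReal with hs₀
  have hs₀S : ENNReal.ofReal (s₀ ^ 2) = sobolevSum B h d s' 0 := by
    rw [Real.sq_sqrt ENNReal.toReal_nonneg, ENNReal.ofReal_toReal hSob]
  set b := ‖blockGram ψ p q‖ with hb
  set κ : ℝ := (q * q + q) * (‖blockOp ψ p q‖ + ‖psiRow ψ p q q‖ + q * q) +
      (‖blockOp ψ p q‖ + ‖psiRow ψ p q q‖) * (q * q) with hκ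
  have hκ0 : 0 ≤ κ := by positivity
  have hsmall := (tendsto_const_mul_rpow_neg hM hs' (κ * (A * (c * b)))).eventually_le_const
    (by norm_num : (0 : ℝ) < 1 / 2)
  have hsmall' := (tendsto_const_mul_rpow_neg hK hs A).eventually_le_const one_pos
  set A₀ := A * (c * b) with hA₀
  have hA₀0 : 0 ≤ A₀ := by positivity
  set Q := 2 * (κ * A₀ + t * (κ * A₀) + t) + 4 * t * (κ * A₀) + s₀ with hQ
  have hQ0 : 0 ≤ Q := by positivity
  have hb0 : 0 ≤ A₀ * b := by positivity
  refine ⟨A₀ * b + Q, by positivity, ?_⟩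
  filter_upwards [hMK', hγ', hsmall, hsmall'] with N h1 h2 h3 h4
  obtain ⟨hg0, hgle, hz0⟩ := gap_bounds hh hζ (M N - 1)
  have hM' : M N - 1 + 1 = M N := Nat.sub_add_cancel (hM1 N)
  have hzb := hh.le_opNorm (M N - 1)
  have hgN := hgap N
  have hZ := hZ0 N
  have hSobN := hsENorm_sub_comp_projFirst_le (hh.hilbertBasis hinj)
    (hh.hilbertBasis_apply hinj) f hd B hs' (hM1 N) (Real.sqrt_nonneg _)
    ((sobolevSum_anti B h d s' (M N)).trans_eq hs₀S.symm)
  set g := ζ (M N - 1) - ζ (M N - 1 + 1) with hg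
  set z := ζ (M N - 1) with hz
  set Z := gapSup ζ (M N)
  set k : ℝ := (K N : ℝ)
  set m : ℝ := (M N : ℝ)
  have hk1 : (1 : ℝ) ≤ k := Nat.one_le_cast.2 (hK1 N)
  have hm1 : (1 : ℝ) ≤ m := Nat.one_le_cast.2 (hM1 N)
  set r := k ^ (-s) with hr
  set w := m ^ (-s') with hw
  have hr0 : 0 < r := by positivity
  have hw0 : 0 ≤ w := by positivity
  have hkr : k ^ s * r = 1 := by
    rw [hr, ← Real.rpow_add (by linarith), add_neg_cancel, Real.rpow_zero]
  -- The growth condition contains one more factor `M ≥ 1` than needed here, and it is dropped.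
  have hrz : r * Z * z⁻¹ ≤ c * w := by
    have e1 := mul_le_mul_rpow_neg hm1 (x := z⁻¹ * Z) (c := c * k ^ s) (by rwa [← mul_assoc])
    calc r * Z * z⁻¹ = r * (1 * (z⁻¹ * Z)) := by ring
      _ ≤ r * (m * (z⁻¹ * Z)) := by gcongr
      _ ≤ r * (c * k ^ s * w) := mul_le_mul_of_nonneg_left e1 hr0.le
      _ = c * (k ^ s * r) * w := by ring
      _ = c * w := by rw [hkr, mul_one]
  have hzinv : z⁻¹ ≤ g⁻¹ := inv_anti₀ hg0 hgle
  have hrg : r * g⁻¹ ≤ c * b * w := by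
    have e1 : 1 ≤ b * z⁻¹ := by
      rw [← div_eq_mul_inv, one_le_div hz0]
      exact hzb
    calc r * g⁻¹ ≤ r * Z := by gcongr
      _ = r * Z * 1 := by ring
      _ ≤ r * Z * (b * z⁻¹) := by gcongr
      _ = b * (r * Z * z⁻¹) := by ring
      _ ≤ b * (c * w) := by gcongr
      _ = _ := by ring
  have hag : A * r * g⁻¹ ≤ A₀ * w := by
    calc A * r * g⁻¹ = A * (r * g⁻¹) := by ring
      _ ≤ A * (c * b * w) := by gcongr
      _ = _ := by ring
  have haz : A * r * z⁻¹ ≤ A₀ * w := le_trans (by gcongr) hag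
  -- The first-stage error itself is also of order `M^{-s'}`; this is needed because `α̂_i` contains
  -- `ψ̂_i` directly.
  have har : A * r ≤ A₀ * b * w := by
    calc A * r = A * r * z⁻¹ * z := by field_simp
      _ ≤ A₀ * w * b := by gcongr
      _ = _ := by ring
  have hγz : γ N * z⁻¹ ≤ w := by
    calc γ N * z⁻¹ ≤ z * w * z⁻¹ := by gcongr
      _ = w := by field_simp
  have hhalf : κ * (A * r) ≤ g / 2 := by
    have e1 : κ * (A * r) * g⁻¹ ≤ 1 / 2 := by
      refine le_trans ?_ h3
      calc κ * (A * r) * g⁻¹ = κ * (A * r * g⁻¹) := by ring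
        _ ≤ κ * (A₀ * w) := by gcongr
        _ = _ := by ring
    rw [← div_eq_mul_inv, div_le_iff₀ hg0] at e1
    linarith
  refine ⟨har.trans ?_, h4, fun ψ' ζ' h' hh' hψ' => ?_⟩
  · exact mul_le_mul_of_nonneg_right (le_add_of_nonneg_right hQ0) hw0
  have key := hsENorm_bHat_sub_le hp hdense hh hh' hB (m := M N - 1) (hγ0 N)
    (by positivity : 0 ≤ A * r) h4 ht0 (by positivity : 0 ≤ s₀ * w) hψ' ht (by rwa [hM'])
    (by linarith) hκ hhalf
  rw [hM'] at key hg
  rw [← hz, ← hg] at key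
  refine key.trans (ENNReal.ofReal_le_ofReal ?_)
  have hκz : κ * (A * r) * z⁻¹ ≤ κ * (A₀ * w) := by
    rw [mul_assoc]
    exact mul_le_mul_of_nonneg_left haz hκ0
  have hκg : κ * (A * r) * g⁻¹ ≤ κ * (A₀ * w) := by
    rw [mul_assoc]
    exact mul_le_mul_of_nonneg_left hag hκ0
  refine (regularized_error_le ht0 hκz hκg hκz hγz).trans ?_
  calc 2 * (κ * (A₀ * w) + t * (κ * (A₀ * w)) + t * w) + 4 * t * (κ * (A₀ * w)) + s₀ * w
      = Q * w := by rw [hQ]; ring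
    _ ≤ _ := mul_le_mul_of_nonneg_right (le_add_of_nonneg_left hb0) hw0

/-- A union bound with `δ / 2` for each input. On the remaining event the implication holds
pointwise, with `C` and the threshold for `N` chosen independently of `ω`. -/
theorem isBigOP_of_deterministic {Ω : Type*} [MeasurableSpace Ω] {μ : Measure Ω}
    {Y Y₁ Y₂ : ℕ → Ω → ℝ≥0∞} {r r₁ r₂ : ℕ → ℝ} (h₁ : IsBigOP μ Y₁ r₁) (h₂ : IsBigOP μ Y₂ r₂)
    (hr₁ : ∀ N, 0 ≤ r₁ N) (hr₂ : ∀ N, 0 ≤ r₂ N)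
    (h : ∀ C₁ C₂ : ℝ, 0 ≤ C₁ → 0 ≤ C₂ → ∃ C : ℝ, ∀ᶠ N in atTop, ∀ ω,
      Y₁ N ω ≤ ENNReal.ofReal (C₁ * r₁ N) → Y₂ N ω ≤ ENNReal.ofReal (C₂ * r₂ N) →
      Y N ω ≤ ENNReal.ofReal (C * r N)) : IsBigOP μ Y r := by
  intro δ hδ
  obtain ⟨C₁, hC₁⟩ := h₁ (δ / 2) (half_pos hδ)
  obtain ⟨C₂, hC₂⟩ := h₂ (δ / 2) (half_pos hδ)
  obtain ⟨C, hC⟩ := h (max C₁ 0) (max C₂ 0) (le_max_right _ _) (le_max_right _ _)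
  refine ⟨C, ?_⟩
  filter_upwards [hC₁, hC₂, hC] with N e1 e2 e3
  have hsub : {ω | ENNReal.ofReal (C * r N) < Y N ω} ⊆
      {ω | ENNReal.ofReal (C₁ * r₁ N) < Y₁ N ω} ∪ {ω | ENNReal.ofReal (C₂ * r₂ N) < Y₂ N ω} := by
    intro ω hω
    by_contra hn
    simp only [Set.mem_union, Set.mem_ofPred_eq, not_or, not_lt] at hn
    refine absurd (e3 ω (hn.1.trans ?_) (hn.2.trans ?_)) (not_le.2 hω)
    · exact ENNReal.ofReal_le_ofReal (mul_le_mul_of_nonneg_right (le_max_left _ _) (hr₁ N))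
    · exact ENNReal.ofReal_le_ofReal (mul_le_mul_of_nonneg_right (le_max_left _ _) (hr₂ N))
  refine (measure_mono hsub).trans ((measure_union_le _ _).trans ((add_le_add e1 e2).trans_eq ?_))
  rw [← ENNReal.ofReal_add (half_pos hδ).le (half_pos hδ).le, add_halves]

end Rates

end

/-! ### Algebra of the coefficient recursion. -/

section Recursion

variable {H : Type*} [NormedAddCommGroup H] [InnerProductSpace ℝ H]

theorem component_rowOp_of_pos {q : ℕ} (β : ℕ → H →L[ℝ] H) {j : ℕ} (hj : 1 ≤ j) :
    component (rowOp fun i : Fin q => β (i + 1)) j = if j ≤ q then β j else 0 := by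
  split_ifs with h
  · exact component_rowOp β hj h
  · rw [component, dif_neg fun hh => h hh.2]

theorem inverse_recursion_of_le {p q : ℕ} {α β ψ : ℕ → H →L[ℝ] H} (hp : 1 ≤ p) (hq : 1 ≤ q)
    (hrec : ∀ m, 1 ≤ m → ψ m = (if m ≤ p then α m else 0) + (if m ≤ q then β m else 0) -
      ∑ j ∈ (Finset.Icc 1 q).filter (· < m), β j ∘L ψ (m - j)) {m : ℕ} (hm : p + q ≤ m) :
    ψ m = -∑ j ∈ Finset.Icc 1 q, β j ∘L ψ (m - j) := by
  have h := hrec m (by omega)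
  rwa [if_neg (by omega), if_neg (by omega), Finset.filter_true_of_mem fun j hj => by
    have := (Finset.mem_Icc.1 hj).2
    omega, add_zero, zero_sub] at h

/-- The formula for `α̂_i` is the recursion solved for `α_i`, so the true operators have the same
form as the estimators. Setting `β_j = 0` for `j > q` reconciles the two ranges of summation. -/
theorem alphaHat_eq {p q : ℕ} {α β ψ : ℕ → H →L[ℝ] H}
    (hrec : ∀ m, 1 ≤ m → ψ m = (if m ≤ p then α m else 0) + (if m ≤ q then β m else 0) -
      ∑ j ∈ (Finset.Icc 1 q).filter (· < m), β j ∘L ψ (m - j)) {i : ℕ} (hi : 1 ≤ i)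
    (hip : i ≤ p) : alphaHat ψ (rowOp fun j : Fin q => β (j + 1)) i = α i := by
  have h := hrec i hi
  have h1 : ∑ j ∈ Finset.Icc 1 (i - 1),
      component (rowOp fun j : Fin q => β (j + 1)) j ∘L ψ (i - j) =
        ∑ j ∈ (Finset.Icc 1 q).filter (· < i), β j ∘L ψ (i - j) := by
    have h2 : (Finset.Icc 1 q).filter (· < i) = (Finset.Icc 1 (i - 1)).filter (· ≤ q) := by
      ext j
      simp only [Finset.mem_filter, Finset.mem_Icc]
      omega
    rw [h2, Finset.sum_filter]
    refine Finset.sum_congr rfl fun j hj => ?_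
    rw [component_rowOp_of_pos β (Finset.mem_Icc.1 hj).1]
    split_ifs
    · rfl
    · rw [ContinuousLinearMap.zero_comp]
  rw [alphaHat, component_rowOp_of_pos β hi, h1]
  rw [if_pos hip] at h
  rw [h]
  abel

end Recursion

end FARMA

/-! ### Assembly of the two stages. -/

theorem mainTheorem4
    {H : Type*} [NormedAddCommGroup H] [InnerProductSpace ℝ H] [CompleteSpace H]
    [TopologicalSpace.SeparableSpace H] [MeasurableSpace H] [BorelSpace H]
    (hH : ¬ FiniteDimensional ℝ H)
    {Ω : Type*} [MeasurableSpace Ω] (μ : Measure Ω) [IsProbabilityMeasure μ]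
    -- the process, its innovations and its operators (operator sequences are indexed from 1)
    (X ε : ℤ → Ω → H) (p q : ℕ) (hp : 1 ≤ p) (hq : 1 ≤ q)
    (α β φ ψ : ℕ → H →L[ℝ] H)
    (hARMA : IsFARMA μ X ε p q α β)
    (herg : IsStationaryErgodic μ ε)
    (hlin : IsCausalLinear μ X ε φ)
    (hinv : IsInvertible μ X ε ψ)
    (hX2 : ∀ k, MemLp (X k) 2 μ) (hε4 : ∀ k, MemLp (ε k) 4 μ)
    (hinj : Function.Injective (covOp μ (ε 0)))
    -- tuning sequences
    (L K M : ℕ → ℕ) (θ γN : ℕ → ℝ)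
    (hL1 : ∀ N, 1 ≤ L N) (hK1 : ∀ N, 1 ≤ K N) (hM1 : ∀ N, 1 ≤ M N)
    (hL : Tendsto L atTop atTop) (hK : Tendsto K atTop atTop) (hM : Tendsto M atTop atTop)
    (hθ0 : ∀ N, 0 < θ N) (hθ : Tendsto θ atTop (𝓝 0))
    (hγ0 : ∀ N, 0 < γN N) (hγ : Tendsto γN atTop (𝓝 0))
    -- rates of the empirical lagged covariance operators
    (hLN : (fun N => (L N : ℝ)) =o[atTop] fun N => (N : ℝ) ^ (1 / 3 : ℝ))
    (hC : IsBigOP μ (fun N ω => hsENorm (empCov X (L N) N ω - covOp μ (lagVec X (L N) 0)))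
      fun N => (L N : ℝ) ^ (3 / 2 : ℝ) * (N : ℝ) ^ (-1 / 2 : ℝ))
    (hD : IsBigOP μ
      (fun N ω => hsENorm (empCross X (L N) N ω - crossCov μ (lagVec X (L N) 0) (X 1)))
      fun N => (L N : ℝ) * (N : ℝ) ^ (-1 / 2 : ℝ))
    -- eigenpairs of the covariance operators of `X^{[L]}` (simple) and of `X`
    (lam : ℕ → ℕ → ℝ) (c : ∀ N, ℕ → HPow H (L N))
    (hc : ∀ N, IsEigenSystem (covOp μ (lagVec X (L N) 0)) (lam N) (c N))
    (hsimple : ∀ N j, lam N j ≠ lam N (j + 1))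
    (mu : ℕ → ℝ) (d : ℕ → H) (hd : IsEigenSystem (covOp μ (X 0)) mu d)
    -- Hilbert-Schmidt operators and Sobolev condition in the inverted representation
    (hψHS : ∀ i, IsHS (ψ (i + 1))) (hψsq : ∑' i : ℕ, hsENorm (ψ (i + 1)) ^ 2 ≠ ⊤)
    (sβ : ℝ) (hsβ : 0 < sβ)
    (hSob : ∀ N, sobolevSum (rowOp fun i : Fin (L N) => ψ (i + 1)) (c N) d sβ 0 ≠ ⊤)
    (hSobLim : limsup
      (fun N => sobolevSum (rowOp fun i : Fin (L N) => ψ (i + 1)) (c N) d sβ (K N)) atTop ≠ ⊤)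
    -- growth conditions of the first stage
    (hθlam : θ =o[atTop] fun N => lam N (K N - 1))
    (hKL : (fun N => (K N : ℝ) ^ (1 + sβ) * (lam N (K N - 1))⁻¹ * gapSup (lam N) (K N) *
      (L N : ℝ) ^ 2) =O[atTop] fun N => (N : ℝ) ^ (1 / 2 : ℝ))
    (hψsum : Summable fun l : ℕ => ‖ψ (l + 1)‖)
    (htail : (fun N => ∑' l : ℕ, ‖ψ (L N + 1 + l)‖) =o[atTop]
      fun N => (K N : ℝ) * gapSup (lam N) (K N) * (L N : ℝ) ^ (3 / 2 : ℝ) *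
        (N : ℝ) ^ (-1 / 2 : ℝ))
    (hθrate : θ =o[atTop]
      fun N => (K N : ℝ) * gapSup (lam N) (K N) * (L N : ℝ) ^ 2 * (N : ℝ) ^ (-1 / 2 : ℝ))
    -- second stage
    (hαHS : ∀ i ∈ Finset.Icc 1 p, IsHS (α i)) (hβHS : ∀ j ∈ Finset.Icc 1 q, IsHS (β j))
    (hdense : DenseRange (blockOp ψ p q))
    (ζ : ℕ → ℝ) (h : ℕ → HPow H q) (hh : IsEigenSystem (blockGram ψ p q) ζ h)
    (hζ : ∀ j, ζ j ≠ ζ (j + 1))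
    (sγ : ℝ) (hsγ : 0 < sγ)
    (hSobB : sobolevSum (rowOp fun j : Fin q => β (j + 1)) h d sγ 0 ≠ ⊤)
    (hMK : (fun N => (M N : ℝ) ^ (1 + sγ) * (ζ (M N - 1))⁻¹ * gapSup ζ (M N)) =O[atTop]
      fun N => (K N : ℝ) ^ sβ)
    (hγrate : γN =o[atTop] fun N => ζ (M N - 1) * (M N : ℝ) ^ (-sγ))
    -- eigenpairs of the empirical operators (any choice of them)
    (lamHat : ℕ → Ω → ℕ → ℝ) (cHat : ∀ N, Ω → ℕ → HPow H (L N))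
    (hcHat : ∀ N ω, IsEigenSystem (empCov X (L N) N ω) (lamHat N ω) (cHat N ω))
    (ψHat : ℕ → Ω → ℕ → H →L[ℝ] H)
    (hψHat : ∀ N ω, ψHat N ω = psiHat X (L N) (K N) N (θ N) ω (cHat N ω))
    (ζHat : ℕ → Ω → ℕ → ℝ) (hHat : ℕ → Ω → ℕ → HPow H q)
    (hhHat : ∀ N ω, IsEigenSystem (blockGram (ψHat N ω) p q) (ζHat N ω) (hHat N ω))
    (BHat : ℕ → Ω → HPow H q →L[ℝ] H)
    (hBHat : ∀ N ω, BHat N ω = bHat (ψHat N ω) p q (M N) (γN N) (hHat N ω)) :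
    IsBigOP μ
      (fun N ω => max
        (⨆ i ∈ Finset.Icc 1 p, hsENorm (alphaHat (ψHat N ω) (BHat N ω) i - α i))
        (⨆ j ∈ Finset.Icc 1 q, hsENorm (component (BHat N ω) j - β j)))
      fun N => (M N : ℝ) ^ (-sγ) := by
  have : SecondCountableTopology H := UniformSpace.secondCountable_of_separable H
  have hε2 := hARMA.whiteNoise.weaklyStationary.memLp
  have S := scoreSystem hARMA.whiteNoise hlin hinv hX2 hε2 hinj hψsum
  have hcov := covOp_lagVec hARMA.centered hX2
  have hcross := crossCov_lagVec hARMA.centered hX2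
  have hrec : ∀ m, 1 ≤ m → ψ m = (if m ≤ p then α m else 0) + (if m ≤ q then β m else 0) -
      ∑ j ∈ (Finset.Icc 1 q).filter (· < m), β j ∘L ψ (m - j) :=
    fun m hm => S.inverse_recursion (scoreMap_eqn hARMA hX2 hε2 0) hm
  set X₀ := scoreMap (hX2 0) with hX₀
  -- the eigenfunctions of the covariance operator of `X` are complete
  have hinj0 : Function.Injective (covOp μ (X 0)) := by
    rw [covOp, crossCov_eq (hX2 0) (hX2 0) (hARMA.centered 0).2 (hARMA.centered 0).2]
    exact adjoint_comp_self_injective fun x hx => S.eq_zero_of_process_eq_zero hx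
  obtain ⟨σ, hσ0, hσ⟩ := (isHS_scoreMap (hX2 0)).exists_le
  have hCinj : ∀ N, Function.Injective (covOp μ (lagVec X (L N) 0)) := fun N => by
    rw [hcov]
    exact adjoint_comp_self_injective (S.lagMap_injective (L N))
  set b := ‖scoreMap (hε2 0)‖ * (1 + ∑' j : ℕ, ‖φ (j + 1)‖) with hb
  have hCb : ∀ N, ‖covOp μ (lagVec X (L N) 0)‖ ≤ b * b := fun N => by
    rw [hcov, ContinuousLinearMap.norm_adjoint_comp_self]
    exact mul_self_le_mul_self (norm_nonneg _) (S.norm_lagMap_le (L N))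
  have hbias : ∀ N, hsENorm (crossCov μ (lagVec X (L N) 0) (X 1) -
      (rowOp fun i : Fin (L N) => ψ (i + 1)) ∘L covOp μ (lagVec X (L N) 0)) ≤
        ENNReal.ofReal (‖X₀‖ * σ * ((∑' l : ℕ, ‖ψ (L N + 1 + l)‖) * √(L N))) := fun N => by
    rw [hcov, hcross]
    refine (S.hsENorm_bias_le (L N) hσ).trans_eq ?_
    congr 1
    ring
  -- Square-summability of the `‖ψ_i‖_S` bounds `Ψ_L` uniformly in `L`.
  have hψt : ∀ N, hsENorm (rowOp fun i : Fin (L N) => ψ (i + 1)) ≤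
      ENNReal.ofReal √(∑' i : ℕ, hsENorm (ψ (i + 1)) ^ 2).toReal := fun N => by
    refine ennreal_le_of_sq_le ?_
    rw [← ENNReal.ofReal_pow (Real.sqrt_nonneg _), Real.sq_sqrt ENNReal.toReal_nonneg,
      ENNReal.ofReal_toReal hψsq, rowOp_eq_rowMap, hsENorm_rowMap_sq,
      Fin.sum_univ_eq_sum_range fun i => hsENorm (ψ (i + 1)) ^ 2]
    exact ENNReal.sum_le_tsum _
  have hBHS : IsHS (rowOp fun j : Fin q => β (j + 1)) := by
    intro htop
    have h1 := hsENorm_rowMap_sq fun j : Fin q => β (j + 1)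
    rw [← rowOp_eq_rowMap, htop] at h1
    refine ENNReal.sum_ne_top.2 (fun j _ => ?_) (h1.symm.trans (ENNReal.top_pow two_ne_zero))
    exact ENNReal.pow_ne_top (hβHS (j + 1) (Finset.mem_Icc.2 ⟨by omega, j.2⟩))
  obtain ⟨tB, htB0, htB⟩ := hBHS.exists_le
  have hψn : ∀ j, 1 ≤ j → ‖ψ j‖ ≤ max (∑' l : ℕ, ‖ψ (l + 1)‖) tB := fun j hj => by
    have h1 := hψsum.le_tsum (j - 1) fun _ _ => norm_nonneg _
    rw [Nat.sub_add_cancel hj] at h1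
    exact h1.trans (le_max_left _ _)
  set t := max (∑' l : ℕ, ‖ψ (l + 1)‖) tB with ht
  have htBt : tB ≤ t := le_max_right _ _
  have ht0 : 0 ≤ t := htB0.trans htBt
  have hBP := rowOp_comp_blockOp (β := β) hp fun m hm => inverse_recursion_of_le hp hq hrec hm
  refine isBigOP_of_deterministic hC hD (fun N => by positivity) (fun N => by positivity)
    fun C₁ C₂ hC₁ hC₂ => ?_
  obtain ⟨A, hA0, hA⟩ := first_stage_rate hL1 hK1 hK hθ0 hc hCinj hsimple
    (hd.hilbertBasis hinj0) (hd.hilbertBasis_apply hinj0) hCb (by positivity)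
    (Real.sqrt_nonneg _) (fun N => tsum_nonneg fun _ => norm_nonneg _) hbias hψt hsβ hSobLim hKL
    htail hθrate hC₁ hC₂
  obtain ⟨A', hA'0, hA'⟩ := second_stage_rate hp hK1 hM1 hK hM hγ0 hBP hdense hh hζ
    (hd.hilbertBasis hinj0) (hd.hilbertBasis_apply hinj0) htB0 htB hsβ hsγ hSobB hMK hγrate hA0
  -- The Lipschitz constant of the `α`-map for `n = p`, times the sum of the two errors, each at
  -- most `A' M^{-γ}`.
  refine ⟨(1 + p * (t + 1)) * (A' + A'), ?_⟩
  -- Once `L ≥ p + 2q`, every `ψ̂_j` that is used is a genuine component of `Ψ̂_L` and not the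
  -- default zero.
  filter_upwards [hA, hA', hL.eventually_ge_atTop (p + 2 * q)] with N h1 h2 h3 ω hCω hDω
  obtain ⟨h2a, h2b, h2c⟩ := h2
  have hΨ := h1 _ _ _ _ (hcHat N ω) hCω hDω
  have hψ : ∀ j, 1 ≤ j → j ≤ p + 2 * q →
      hsENorm (ψHat N ω j - ψ j) ≤ ENNReal.ofReal (A * (K N : ℝ) ^ (-sβ)) := fun j hj hj' => by
    rw [hψHat, psiHat, ← component_rowOp ψ hj (hj'.trans h3), component_sub]
    exact (hsENorm_component_le _ _).trans hΨ
  have hB := h2c _ _ _ (hhHat N ω) hψ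
  rw [← hBHat] at hB
  set w := (M N : ℝ) ^ (-sγ) with hw
  have hw0 : 0 ≤ w := by positivity
  have hle : A' * w ≤ (1 + p * (t + 1)) * (A' + A') * w := by
    gcongr
    have : 0 ≤ (p : ℝ) * (t + 1) := by positivity
    nlinarith
  refine max_le (iSup₂_le fun i hi => ?_) (iSup₂_le fun j hj => ?_)
  · rw [Finset.mem_Icc] at hi
    rw [← alphaHat_eq hrec hi.1 hi.2]
    refine (hsENorm_alphaHat_sub_le hi.1 hi.2 (by positivity) h2b (by positivity) ht0
      (fun j h1 h2 => hψ j h1 (by omega)) hB (fun j hj _ => hψn j hj)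
      (htB.trans (ENNReal.ofReal_le_ofReal htBt))).trans (ENNReal.ofReal_le_ofReal ?_)
    rw [mul_assoc (1 + (p : ℝ) * (t + 1)), add_mul A']
    exact mul_le_mul_of_nonneg_left (add_le_add_left h2a _) (by positivity)
  · rw [Finset.mem_Icc] at hj
    rw [← component_rowOp β hj.1 hj.2, component_sub]
    exact (hsENorm_component_le _ _).trans (hB.trans (ENNReal.ofReal_le_ofReal hle))
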